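/- Lemma (Lack of stabilisability for constant control gains). Let $p<0$, $r=\sqrt{-p}$, $T=2\pi$, and consider the subcritical Hopf normal form with constant rotation and scalar input $u$ entering along $b=[1,1]^T$, $$\dot x_1=p x_1-x_2+x_1(x_1^2+x_2^2)+u,\qquad \dot x_2=x_1+p x_2+x_2(x_1^2+x_2^2)+u,$$ which for $u=0$ has the $T$-periodic orbit $x_*(t)=[r\sin t,\,-r\cos t]^T$. Let $K_1,K_2\in\mathbb R$ be arbitrary constants. Then there exists $\varepsilon_{\max}>0$ such that for all $\varepsilon\in(0,\varepsilon_{\max})$ the periodic orbit $x=\tilde x=x_*$ of the system with extended time-delayed feedback $$u(t)=K_1[\tilde x_1(t)-x_1(t)]+K_2[\tilde x_2(t)-x_2(t)],\qquad \tilde x_j(t)=(1-\varepsilon)\tilde x_j(t-T)+\varepsilon x_j(t-T)\quad(j=1,2)$$ is unstable, in both of the following senses. (i) Linear instability: the linearisation along $x=\tilde x=x_*$ has a Floquet multiplier $\lambda\in\mathbb C$ with $|\lambda|>1$, that is, an eigenvalue of its time-$T$ map acting on continuous history segments $(y,\tilde y)$ on $[-T,0]$ with $\tilde y(0)=(1-\varepsilon)\tilde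 y(-T)+\varepsilon y(-T)$. (ii) Orbital instability: the orbit is not orbitally Lyapunov stable. That is, there is $\eta>0$ such that for every $\delta>0$ there are a solution $(x,\tilde x)$ on some interval $[-T,\tau]$, $\tau\ge 0$ (continuous on $[-T,\tau]$ and satisfying the system on $[0,\tau]$), a phase $s_0\in\mathbb R$ and a time $t\in[0,\tau]$ such that $$|x(\theta)-x_*(s_0+\theta)|<\delta,\qquad |\tilde x(\theta)-x_*(s_0+\theta)|<\delta\qquad\text{for all }\theta\in[-T,0],$$ while for every $s\in\mathbb R$ there is $\theta\in[-T,0]$ with $|x(t+\theta)-x_*(s+\theta)|\ge\eta$ or $|\tilde x(t+\theta)-x_*(s+\theta)|\ge\eta$. -/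

import Mathlib

open Set

noncomputable section

namespace ETDF

/-- The state space `ℝⁿ` with its Euclidean norm. -/
abbrev State (n : ℕ) : Type := EuclideanSpace ℝ (Fin n)

/-- `(x, xt)` is a (classical) solution on `[-T, τ]` of the system with extended time-delayed
feedback and constant gains `K`,
`x'(t) = f (x(t), Kᵀ (xt(t) - x(t)))`, `xt(t) = (1 - ε) xt(t - T) + ε x(t - T)` for `0 ≤ t ≤ τ`.
Its initial value is the pair of continuous history segments on `[-T, 0]`, and the recursion
at `t = 0` is the compatibility condition that defines the phase space. -/
structure IsSolution {n : ℕ} (f : State n → ℝ → State n) (K : State n) (T ε τ : ℝ)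
    (x xt : ℝ → State n) : Prop where
  continuousOn_state : ContinuousOn x (Icc (-T) τ)
  continuousOn_reference : ContinuousOn xt (Icc (-T) τ)
  ode : ∀ t ∈ Icc (0 : ℝ) τ,
    HasDerivWithinAt x (f (x t) (∑ j, K j * (xt t j - x t j))) (Icc 0 τ) t
  recursion : ∀ t ∈ Icc (0 : ℝ) τ, xt t = (1 - ε) • xt (t - T) + ε • x (t - T)

/-- The history segment of `(x, xt)` at time `t` (a function on `[-T, 0]`) is uniformly
`η`-close to the segment of `(xs, xs)` at time `s`. -/
def SegmentClose {n : ℕ} (T η : ℝ) (x xt xs : ℝ → State n) (t s : ℝ) : Prop :=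
  ∀ θ ∈ Icc (-T) 0, dist (x (t + θ)) (xs (s + θ)) < η ∧ dist (xt (t + θ)) (xs (s + θ)) < η

/-- Orbital (Lyapunov) stability of the periodic orbit `x = xt = xs` in the phase space of
history segments: solutions that start close to the orbit stay close to it, for as long as
they exist. -/
def OrbitallyStable {n : ℕ} (f : State n → ℝ → State n) (K : State n) (T ε : ℝ)
    (xs : ℝ → State n) : Prop :=
  ∀ η > 0, ∃ δ > 0, ∀ τ ≥ 0, ∀ x xt : ℝ → State n, IsSolution f K T ε τ x xt →
    (∃ s, SegmentClose T δ x xt xs 0 s) →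
      ∀ t ∈ Icc (0 : ℝ) τ, ∃ s, SegmentClose T η x xt xs t s

/-- `A(t) = ∂ₓ f(xs(t), 0)`, as a matrix. -/
def jacobian {n : ℕ} (f : State n → ℝ → State n) (xs : ℝ → State n) (t : ℝ) :
    Matrix (Fin n) (Fin n) ℝ :=
  Matrix.of fun i j =>
    (fderiv ℝ (fun x : State n => f x 0) (xs t) (EuclideanSpace.single j 1)) i

/-- `b(t) = ∂ᵤ f(xs(t), 0)`. -/
def inputVector {n : ℕ} (f : State n → ℝ → State n) (xs : ℝ → State n) (t : ℝ) : State n :=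
  deriv (fun u : ℝ => f (xs t) u) 0

/-- `l` is a Floquet multiplier of the orbit `x = xt = xs`: an eigenvalue of the time-`T` map of
the (complexified) linearisation `y' = A(t) y + b(t) Kᵀ (yt - y)`,
`yt(t) = (1 - ε) yt(t - T) + ε y(t - T)`, acting on pairs of history segments on `[-T, 0]`. -/
def IsFloquetMultiplier {n : ℕ} (f : State n → ℝ → State n) (K : State n) (T ε : ℝ)
    (xs : ℝ → State n) (l : ℂ) : Prop :=
  ∃ y yt : ℝ → Fin n → ℂ,
    ContinuousOn y (Icc (-T) T) ∧ ContinuousOn yt (Icc (-T) T) ∧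
    (∀ t ∈ Icc (0 : ℝ) T, ∀ i,
      HasDerivWithinAt (fun s => y s i)
        (∑ j, (jacobian f xs t i j : ℂ) * y t j
          + (inputVector f xs t i : ℂ) * ∑ j, (K j : ℂ) * (yt t j - y t j)) (Icc 0 T) t) ∧
    (∀ t ∈ Icc (0 : ℝ) T,
      yt t = ((1 - ε : ℝ) : ℂ) • yt (t - T) + (ε : ℂ) • y (t - T)) ∧
    (∀ t ∈ Icc (-T) 0, y (t + T) = l • y t ∧ yt (t + T) = l • yt t) ∧
    ∃ t ∈ Icc (-T) 0, y t ≠ 0 ∨ yt t ≠ 0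

/-- The subcritical Hopf normal form with constant rotation and control input direction
`b = (1, 1)`. -/
def hopfField (p : ℝ) (x : State 2) (u : ℝ) : State 2 :=
  !₂[p * x 0 - x 1 + x 0 * (x 0 ^ 2 + x 1 ^ 2) + u,
     x 0 + p * x 1 + x 1 * (x 0 ^ 2 + x 1 ^ 2) + u]

/-- The periodic orbit `(r sin t, -r cos t)`, `r = √(-p)`, of the uncontrolled normal form. -/
def hopfOrbit (p : ℝ) (t : ℝ) : State 2 :=
  !₂[Real.sqrt (-p) * Real.sin t, -(Real.sqrt (-p) * Real.cos t)]

end ETDF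

end

/-! In coordinates rotating with the orbit (radial and tangential components) the uncontrolled
linearisation is constant, `diag(2r², 0)`, and the feedback term becomes a periodic matrix of trace
`K₁ + K₂`. For a multiplier `l` the recursion forces `yt = b y` with `b = ε / (l - 1 + ε)`. The
delay then disappears: `l` is a multiplier of the ordinary differential equation `y' = (drift - s ·
feedback) y` with the effective gain `s = (l - 1) / (l - 1 + ε)`. One has to solve a 2×2
characteristic equation whose matrix depends on `l` through `s`.

If `K₁ + K₂ < 0`, Liouville's formula at `s = 1` gives the monodromy determinant `exp(2π(2r² - K₁ -
K₂)) > 1`, so an eigenvalue lies outside the unit circle. Since `s → 1` as `ε → 0` away from `l =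
1`, this root persists for small `ε` (`exists_charVal_effectiveGain_root`). If `K₁ + K₂ ≥ 0`, the
ansatz `l = 1 + εx` gives `s = x / (1 + x)`. After division by the factor `s`, the characteristic
function changes sign on `x > 0`, so there is a real multiplier above 1 (`exists_pos_root_of_real`).
The two cases meet in `exists_unstable_multiplier`.

Orbital instability follows from the same multiplier. Spectral values of the time-`T` map outside
the unit disc are eigenvalues (`exists_eigenvector_of_mem_spectrum`). Starting from one of maximal
modulus, a Lyapunov–Perron fixed point (`exists_backward_trajectory`) gives a nonzero solution of
the full nonlinear system that tends to the orbit backward in time. This deviation is not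
`T`-periodic in time, because a `T`-periodic one tending to zero vanishes. A segment of length `T`
close to the orbit at any phase has nearly equal end points, so a solution with `x(t) ≠ x(t - T)`
stays a fixed distance away from the orbit at that `t`, however close to the orbit it began. -/

namespace ETDF

set_option linter.unusedSectionVars false
set_option linter.unnecessarySimpa false

/-! ### Linear Volterra equations on one period. -/

section Volterra

open MeasureTheory

variable {T : ℝ} [hT : Fact (0 < T)] {F : Type*} [NormedAddCommGroup F] [NormedSpace ℂ F]

/-- The left end point of the interval. -/
def leftEnd (T : ℝ) [hT : Fact (0 < T)] : Icc (0 : ℝ) T := ⟨0, le_rfl, hT.out.le⟩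

/-- The right end point of the interval. -/
def rightEnd (T : ℝ) [hT : Fact (0 < T)] : Icc (0 : ℝ) T := ⟨T, hT.out.le, le_rfl⟩

theorem continuous_extend (f : C(Icc (0 : ℝ) T, F)) : Continuous (IccExtend hT.out.le f) :=
  f.continuous.Icc_extend'

theorem norm_integral_extend_le (f : C(Icc (0 : ℝ) T, F)) {C : ℝ} {n : ℕ}
    (hf : ∀ t : Icc (0 : ℝ) T, ‖f t‖ ≤ C * (t : ℝ) ^ n) (t : Icc (0 : ℝ) T) :
    ‖∫ τ in (0 : ℝ)..t, IccExtend hT.out.le f τ‖ ≤ C * ((t : ℝ) ^ (n + 1) / (n + 1)) := by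
  have h : ‖∫ τ in (0 : ℝ)..t, IccExtend hT.out.le f τ‖ ≤ ∫ τ in (0 : ℝ)..t, C * τ ^ n := by
    refine intervalIntegral.norm_integral_le_of_norm_le t.2.1 (ae_of_all _ fun τ hτ => ?_)
      (Continuous.intervalIntegrable (by fun_prop) _ _)
    have hm : τ ∈ Icc (0 : ℝ) T := ⟨hτ.1.le, hτ.2.trans t.2.2⟩
    rw [IccExtend_of_mem _ _ hm]
    exact hf ⟨τ, hm⟩
  simpa using h

/-- The Volterra integration operator `f ↦ ∫₀ᵗ f`. -/
noncomputable def volterra (T : ℝ) [hT : Fact (0 < T)] (F : Type*) [NormedAddCommGroup F]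
    [NormedSpace ℂ F] : C(Icc (0 : ℝ) T, F) →L[ℂ] C(Icc (0 : ℝ) T, F) :=
  LinearMap.mkContinuous
    { toFun := fun f => ⟨fun t => ∫ τ in (0 : ℝ)..t, IccExtend hT.out.le f τ, by
        have := intervalIntegral.continuous_primitive
          (fun a b => (continuous_extend f).intervalIntegrable (μ := volume) a b) 0
        exact this.comp continuous_subtype_val⟩
      map_add' := fun f g => by
        ext t
        have := intervalIntegral.integral_add
          ((continuous_extend f).intervalIntegrable (μ := volume) 0 t)
          ((continuous_extend g).intervalIntegrable (μ := volume) 0 t)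
        simpa [IccExtend] using this
      map_smul' := fun c f => by
        ext t
        have := intervalIntegral.integral_smul (a := 0) (b := t) (μ := volume) c
          (IccExtend hT.out.le f)
        simpa [IccExtend] using this } T (fun f => by
    refine (ContinuousMap.norm_le _ (by have := hT.out; positivity)).2 fun t => ?_
    have := norm_integral_extend_le f (C := ‖f‖) (n := 0) (by simpa using f.norm_coe_le_norm) t
    refine this.trans ?_
    have ht := t.2.2
    have := norm_nonneg f
    simp only [zero_add, pow_one, Nat.cast_zero, div_one]
    nlinarith)

theorem volterra_apply (f : C(Icc (0 : ℝ) T, F)) (t : Icc (0 : ℝ) T) :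
    volterra T F f t = ∫ τ in (0 : ℝ)..t, IccExtend hT.out.le f τ := rfl

@[simp] theorem volterra_leftEnd (f : C(Icc (0 : ℝ) T, F)) :
    volterra T F f (leftEnd T) = 0 := by
  simp [volterra_apply, leftEnd]

/-- Pointwise application of a continuous family of operators. -/
noncomputable def mulOp (N : C(Icc (0 : ℝ) T, F →L[ℂ] F)) :
    C(Icc (0 : ℝ) T, F) →L[ℂ] C(Icc (0 : ℝ) T, F) :=
  LinearMap.mkContinuous
    { toFun := fun f => ⟨fun t => N t (f t), by fun_prop⟩
      map_add' := fun f g => by ext t; simp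
      map_smul' := fun c f => by ext t; simp } ‖N‖ (fun f => by
    refine (ContinuousMap.norm_le _ (by positivity)).2 fun t => ?_
    exact ((N t).le_opNorm _).trans
      (mul_le_mul (N.norm_coe_le_norm t) (f.norm_coe_le_norm t) (norm_nonneg _) (by positivity)))

@[simp] theorem mulOp_apply (N : C(Icc (0 : ℝ) T, F →L[ℂ] F)) (f : C(Icc (0 : ℝ) T, F))
    (t : Icc (0 : ℝ) T) : mulOp N f t = N t (f t) := rfl

/-- Each integration turns `t ^ n` into `t ^ (n + 1) / (n + 1)`; the accumulated denominators are
the factorial that makes the operator quasinilpotent. -/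
theorem norm_volterra_mulOp_pow_apply_le (N : C(Icc (0 : ℝ) T, F →L[ℂ] F))
    (f : C(Icc (0 : ℝ) T, F)) (n : ℕ) (t : Icc (0 : ℝ) T) :
    ‖((volterra T F * mulOp N) ^ n) f t‖ ≤ ‖N‖ ^ n / n.factorial * ‖f‖ * (t : ℝ) ^ n := by
  induction n generalizing t with
  | zero => simpa using f.norm_coe_le_norm t
  | succ n ih =>
    rw [pow_succ', mul_apply_eq_comp, mul_apply_eq_comp, volterra_apply]
    refine (norm_integral_extend_le _ (C := ‖N‖ * (‖N‖ ^ n / n.factorial * ‖f‖)) (n := n)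
      (fun s => ?_) t).trans (le_of_eq ?_)
    · rw [mulOp_apply, mul_assoc]
      exact ((N s).le_opNorm _).trans
        (mul_le_mul (N.norm_coe_le_norm s) (ih s) (norm_nonneg _) (by positivity))
    · rw [Nat.factorial_succ]
      push_cast
      field_simp
      ring

theorem norm_volterra_mulOp_pow_le (N : C(Icc (0 : ℝ) T, F →L[ℂ] F)) (n : ℕ) :
    ‖(volterra T F * mulOp N) ^ n‖ ≤ (‖N‖ * T) ^ n / n.factorial := by
  have h0 := hT.out
  refine ContinuousLinearMap.opNorm_le_bound _ (by positivity) fun f => ?_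
  refine (ContinuousMap.norm_le _ (by positivity)).2 fun t => ?_
  refine (norm_volterra_mulOp_pow_apply_le N f n t).trans ?_
  have : (t : ℝ) ^ n ≤ T ^ n := pow_le_pow_left₀ t.2.1 t.2.2 n
  calc ‖N‖ ^ n / n.factorial * ‖f‖ * (t : ℝ) ^ n ≤ ‖N‖ ^ n / n.factorial * ‖f‖ * T ^ n := by gcongr
    _ = _ := by rw [mul_pow]; ring

variable [CompleteSpace F]

/-- Some power `x ^ n` has norm below 1, so `1 - x ^ n` is a unit, and `1 - x` is a factor of it
that commutes with the cofactor. Neither `N` nor `T` need be small. -/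
theorem isUnit_one_sub_volterra_mulOp (N : C(Icc (0 : ℝ) T, F →L[ℂ] F)) :
    IsUnit (1 - volterra T F * mulOp N) := by
  obtain ⟨n, hn⟩ := ((FloorSemiring.tendsto_pow_div_factorial_atTop (‖N‖ * T)).eventually
    (gt_mem_nhds zero_lt_one)).exists
  set x := volterra T F * mulOp N
  have hx : ‖x ^ n‖ < 1 := (norm_volterra_mulOp_pow_le N n).trans_lt hn
  have hu : IsUnit (1 - x ^ n) := ⟨Units.oneSub (x ^ n) hx, rfl⟩
  rw [← mul_neg_geom_sum x n] at hu
  have hc : Commute (1 - x) (∑ i ∈ Finset.range n, x ^ i) := by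
    refine Commute.sum_right _ _ _ fun i _ => ?_
    exact (Commute.one_left _).sub_left (Commute.refl x |>.pow_right i)
  exact (hc.isUnit_mul_iff.1 hu).1

/-- The solution operator `f ↦ y` of `y = f + ∫ N y`. -/
noncomputable def solOp (N : C(Icc (0 : ℝ) T, F →L[ℂ] F)) :
    C(Icc (0 : ℝ) T, F) →L[ℂ] C(Icc (0 : ℝ) T, F) :=
  Ring.inverse (1 - volterra T F * mulOp N)

theorem solOp_eq_iff (N : C(Icc (0 : ℝ) T, F →L[ℂ] F)) (f y : C(Icc (0 : ℝ) T, F)) :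
    solOp N f = y ↔ y = f + volterra T F (mulOp N y) := by
  have hu := isUnit_one_sub_volterra_mulOp N
  have h1 : ∀ g, solOp N ((1 - volterra T F * mulOp N) g) = g := fun g => by
    have := DFunLike.congr_fun (Ring.inverse_mul_cancel _ hu) g
    exact this
  have h2 : ∀ g, (1 - volterra T F * mulOp N) (solOp N g) = g := fun g => by
    have := DFunLike.congr_fun (Ring.mul_inverse_cancel _ hu) g
    exact this
  have h3 : y = f + volterra T F (mulOp N y) ↔ (1 - volterra T F * mulOp N) y = f := by
    rw [sub_apply, sub_eq_iff_eq_add]; rfl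
  rw [h3]
  constructor
  · rintro rfl; exact h2 f
  · rintro rfl; exact h1 y

theorem solOp_eq (N : C(Icc (0 : ℝ) T, F →L[ℂ] F)) (f : C(Icc (0 : ℝ) T, F)) :
    solOp N f = f + volterra T F (mulOp N (solOp N f)) :=
  (solOp_eq_iff N f _).1 rfl

theorem solOp_leftEnd (N : C(Icc (0 : ℝ) T, F →L[ℂ] F)) (f : C(Icc (0 : ℝ) T, F)) :
    solOp N f (leftEnd T) = f (leftEnd T) := by
  rw [solOp_eq]; simp

theorem hasDerivWithinAt_volterra (f : C(Icc (0 : ℝ) T, F)) (t : Icc (0 : ℝ) T) :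
    HasDerivWithinAt (IccExtend hT.out.le (volterra T F f)) (f t) (Icc 0 T) t := by
  have h := ((continuous_extend f).integral_hasStrictDerivAt 0 (t : ℝ)).hasDerivAt.hasDerivWithinAt
    (s := Icc 0 T)
  rw [IccExtend_of_mem _ _ t.2] at h
  exact h.congr (fun s hs => by rw [IccExtend_of_mem _ _ hs]; rfl)
    (by rw [IccExtend_of_mem _ _ t.2]; rfl)

end Volterra

/-! ### Lyapunov–Perron construction of backward trajectories. -/

section BackwardTrajectory

open Filter Topology

variable {X : Type*} [NormedAddCommGroup X] [NormedSpace ℝ X] [CompleteSpace X]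

/-- A linear backward trajectory of growth `ρ` of a bounded operator `L` with
`∑ ‖L ^ j‖ ρ ^ (-2 j) < ∞` continues to the equation perturbed by a quadratically small
nonlinearity. -/
theorem exists_backward_trajectory (L : X →L[ℝ] X) {σ : ℝ} (hσ0 : 0 < σ) (hσ1 : σ < 1)
    (hL : Summable fun j : ℕ => ‖L ^ j‖ * (σ ^ 2) ^ j) {v : ℕ → X}
    (hv : ∀ k, L (v (k + 1)) = v k) {Cv : ℝ} (hvb : ∀ k, ‖v k‖ ≤ Cv * σ ^ k)
    {G : X → X} (hG0 : G 0 = 0) {c : ℝ} (hc : 0 ≤ c)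
    (hG : ∀ a b, ‖a‖ ≤ 1 → ‖b‖ ≤ 1 → ‖G a - G b‖ ≤ c * (‖a‖ + ‖b‖) * ‖a - b‖) :
    ∃ Z : ℕ → X, Tendsto Z atTop (𝓝 0) ∧ (∀ k, Z k = L (Z (k + 1)) + G (Z k)) ∧
      ∃ a : ℝ, a ≠ 0 ∧ ((∀ k, G (Z k) = 0) → ∀ k, Z k = a • v k) := by
  set S : ℝ := ∑' j : ℕ, ‖L ^ j‖ * (σ ^ 2) ^ j with hS
  have hS0 : 0 ≤ S := tsum_nonneg fun j => by positivity
  have hCv : 0 ≤ Cv := by simpa using (norm_nonneg _).trans (hvb 0)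
  -- The radius is chosen so that the nonlinear part has Lipschitz constant at most `1 / 4` on the
  -- ball.
  set R : ℝ := 1 / (1 + 8 * c * S) with hR
  have hcS : 0 ≤ c * S := mul_nonneg hc hS0
  have hRpos : 0 < R := by rw [hR]; apply one_div_pos.2; nlinarith
  have hR1 : R ≤ 1 := by rw [hR]; exact div_le_one_of_le₀ (by nlinarith) (by nlinarith)
  have hRS : S * (2 * c * R) ≤ 1 / 4 := by
    rw [hR]
    have : 0 < 1 + 8 * c * S := by nlinarith
    rw [mul_one_div, mul_div_assoc', div_le_iff₀ this]
    nlinarith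
  have hpow : ∀ k : ℕ, 0 < σ ^ k := fun k => pow_pos hσ0 k
  have hpow1 : ∀ k : ℕ, σ ^ k ≤ 1 := fun k => pow_le_one₀ hσ0.le hσ1.le
  have key : ∀ (k j : ℕ) (x y : X) (d : ℝ), ‖x‖ ≤ R → ‖y‖ ≤ R → ‖x - y‖ ≤ d →
      ‖(L ^ j) (G (σ ^ (k + j) • x)) - (L ^ j) (G (σ ^ (k + j) • y))‖ ≤
        ‖L ^ j‖ * (σ ^ 2) ^ j * (σ ^ k * (2 * c * R * d)) := by
    intro k j x y d hx hy hd
    have hn : ∀ z : X, ‖σ ^ (k + j) • z‖ = σ ^ (k + j) * ‖z‖ := fun z => by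
      rw [norm_smul, Real.norm_of_nonneg (hpow _).le]
    have hle : ∀ z : X, ‖z‖ ≤ R → ‖σ ^ (k + j) • z‖ ≤ 1 := fun z hz => by
      rw [hn]
      exact mul_le_one₀ (hpow1 _) (norm_nonneg _) (hz.trans hR1)
    rw [← map_sub]
    refine ((L ^ j).le_opNorm _).trans ?_
    rw [mul_assoc]
    refine mul_le_mul_of_nonneg_left ?_ (norm_nonneg _)
    refine (hG _ _ (hle x hx) (hle y hy)).trans ?_
    rw [← smul_sub, hn, hn, hn]
    have h1 : c * (σ ^ (k + j) * ‖x‖ + σ ^ (k + j) * ‖y‖) * (σ ^ (k + j) * ‖x - y‖)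
        = (σ ^ 2) ^ j * σ ^ k * σ ^ k * (c * (‖x‖ + ‖y‖) * ‖x - y‖) := by
      rw [pow_add]; ring
    rw [h1]
    have h2 : c * (‖x‖ + ‖y‖) * ‖x - y‖ ≤ 2 * c * R * d := by
      refine mul_le_mul ?_ hd (norm_nonneg _) (by positivity)
      nlinarith
    have h3 : (0 : ℝ) ≤ 2 * c * R * d := (by positivity : (0:ℝ) ≤ c * (‖x‖ + ‖y‖) * ‖x - y‖).trans h2
    calc (σ ^ 2) ^ j * σ ^ k * σ ^ k * (c * (‖x‖ + ‖y‖) * ‖x - y‖)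
        ≤ (σ ^ 2) ^ j * σ ^ k * 1 * (2 * c * R * d) := by
          have := hpow1 k
          gcongr
      _ = _ := by ring
  have key0 : ∀ (k j : ℕ) (x : X), ‖x‖ ≤ R → ‖(L ^ j) (G (σ ^ (k + j) • x))‖ ≤
        ‖L ^ j‖ * (σ ^ 2) ^ j * (σ ^ k * (2 * c * R * R)) := fun k j x hx => by
    have := key k j x 0 R hx (by simpa using hRpos.le) (by simpa using hx)
    simpa [hG0] using this
  -- The linear part `a • v` takes at most half of the radius and the nonlinear sum at most a
  -- quarter.
  set a : ℝ := R / (2 * (Cv + 1)) with ha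
  have hapos : 0 < a := by positivity
  have haR : a * Cv ≤ R / 2 := by
    rw [ha, div_mul_eq_mul_div, div_le_div_iff₀ (by positivity) (by positivity)]
    nlinarith
  -- The unknown is the rescaled sequence `u k = σ ^ (-k) • Z k`, so that the decay of `Z` is built
  -- into the space.
  let B := Metric.closedBall (0 : BoundedContinuousFunction ℕ X) R
  have hB : ∀ (u : B) (k : ℕ), ‖(u : BoundedContinuousFunction ℕ X) k‖ ≤ R := fun u k =>
    (BoundedContinuousFunction.norm_coe_le_norm _ k).trans (mem_closedBall_zero_iff.1 u.2)
  have hsum : ∀ (u : B) (k : ℕ), Summable fun j : ℕ =>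
      (L ^ j) (G (σ ^ (k + j) • (u : BoundedContinuousFunction ℕ X) (k + j))) := fun u k =>
    Summable.of_norm_bounded (hL.mul_right (σ ^ k * (2 * c * R * R))) fun j => key0 k j _ (hB u _)
  -- This is the variation of constants formula `Z k = a v k + ∑ L ^ j G(Z (k + j))`. Quadratic
  -- smallness gives `G(Z (k + j)) = O(σ ^ (2 (k + j)))`, which the summability of `‖L ^ j‖ σ ^ (2
  -- j)` absorbs; no spectral gap is needed.
  let Φ : B → ℕ → X := fun u k => (σ ^ k)⁻¹ • (a • v k + ∑' j : ℕ,
      (L ^ j) (G (σ ^ (k + j) • (u : BoundedContinuousFunction ℕ X) (k + j))))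
  have hΦ : ∀ u k, ‖Φ u k‖ ≤ R := by
    intro u k
    have h1 : ‖∑' j : ℕ, (L ^ j) (G (σ ^ (k + j) • (u : BoundedContinuousFunction ℕ X) (k + j)))‖
        ≤ S * (σ ^ k * (2 * c * R * R)) := by
      rw [hS, ← tsum_mul_right]
      exact tsum_of_norm_bounded (hL.mul_right _).hasSum fun j => key0 k j _ (hB u _)
    have h2 : ‖a • v k‖ ≤ a * Cv * σ ^ k := by
      rw [norm_smul, Real.norm_of_nonneg hapos.le, mul_assoc]
      exact mul_le_mul_of_nonneg_left (hvb k) hapos.le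
    rw [norm_smul, norm_inv, Real.norm_of_nonneg (hpow k).le, inv_mul_le_iff₀ (hpow k)]
    refine (norm_add_le _ _).trans ((add_le_add h2 h1).trans ?_)
    have h3 : a * Cv + S * (2 * c * R) * R ≤ R := by nlinarith
    calc _ = σ ^ k * (a * Cv + S * (2 * c * R) * R) := by ring
      _ ≤ σ ^ k * R := by have := (hpow k).le; gcongr
  let Ψ : B → B := fun u => ⟨BoundedContinuousFunction.ofNormedAddCommGroupDiscrete (Φ u) R (hΦ u),
    by simpa [B] using (BoundedContinuousFunction.norm_le hRpos.le).2 (hΦ u)⟩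
  have hΨ : ∀ (u : B) k, (Ψ u : BoundedContinuousFunction ℕ X) k = Φ u k := fun u k => rfl
  have : CompleteSpace B := Metric.isClosed_closedBall.completeSpace_coe
  have : Nonempty B := ⟨⟨0, by simpa [B] using hRpos.le⟩⟩
  have hcontr : ContractingWith (1 / 4) Ψ := by
    refine ⟨by norm_num [← NNReal.coe_lt_coe], LipschitzWith.of_dist_le_mul fun u w => ?_⟩
    rw [Subtype.dist_eq, BoundedContinuousFunction.dist_le (by positivity)]
    intro k
    rw [hΨ, hΨ, dist_eq_norm]
    simp only [Φ]
    rw [← smul_sub, add_sub_add_left_eq_sub, ← (hsum u k).tsum_sub (hsum w k)]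
    have h1 : ‖∑' j : ℕ, ((L ^ j) (G (σ ^ (k + j) • (u : BoundedContinuousFunction ℕ X) (k + j)))
        - (L ^ j) (G (σ ^ (k + j) • (w : BoundedContinuousFunction ℕ X) (k + j))))‖
        ≤ S * (σ ^ k * (2 * c * R * dist u w)) := by
      rw [hS, ← tsum_mul_right]
      refine tsum_of_norm_bounded (hL.mul_right _).hasSum fun j =>
        key k j _ _ _ (hB u _) (hB w _) ?_
      rw [← dist_eq_norm]
      exact BoundedContinuousFunction.dist_coe_le_dist _
    rw [norm_smul, norm_inv, Real.norm_of_nonneg (hpow k).le, inv_mul_le_iff₀ (hpow k)]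
    refine h1.trans ?_
    have h4 := mul_le_mul_of_nonneg_right hRS (dist_nonneg (x := u) (y := w))
    calc _ = σ ^ k * (S * (2 * c * R) * dist u w) := by ring
      _ ≤ σ ^ k * (1 / 4 * dist u w) := by have := (hpow k).le; gcongr
      _ = _ := by simp
  set u := hcontr.fixedPoint
  have hu : Ψ u = u := hcontr.fixedPoint_isFixedPt
  let Z : ℕ → X := fun k => σ ^ k • (u : BoundedContinuousFunction ℕ X) k
  have hZ : ∀ k, Z k = a • v k + ∑' j : ℕ, (L ^ j) (G (Z (k + j))) := by
    intro k
    have h := hΨ u k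
    rw [hu] at h
    simp only [Z]
    rw [h]
    simp only [Φ]
    rw [smul_inv_smul₀ (hpow k).ne']
  refine ⟨Z, ?_, ?_, a, hapos.ne', ?_⟩
  · refine squeeze_zero_norm (a := fun k => σ ^ k * R) (fun k => ?_) ?_
    · simp only [Z]
      rw [norm_smul, Real.norm_of_nonneg (hpow k).le]
      exact mul_le_mul_of_nonneg_left (hB u k) (hpow k).le
    · simpa using (tendsto_pow_atTop_nhds_zero_of_lt_one hσ0.le hσ1).mul_const R
  · intro k
    have h1 : L (Z (k + 1)) = a • v k + ∑' j : ℕ, (L ^ (j + 1)) (G (Z (k + (j + 1)))) := by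
      rw [hZ (k + 1), map_add, map_smul, hv, L.map_tsum (hsum u (k + 1))]
      congr 1
      refine tsum_congr fun j => ?_
      rw [pow_succ', mul_apply_eq_comp, show k + (j + 1) = k + 1 + j by ring]
    have h2 : ∑' j : ℕ, (L ^ j) (G (Z (k + j)))
        = G (Z k) + ∑' j : ℕ, (L ^ (j + 1)) (G (Z (k + (j + 1)))) := by
      have h3 := (hsum u k).tsum_eq_zero_add
      rw [pow_zero, one_apply_eq_self, add_zero] at h3
      exact h3
    calc Z k = a • v k + ∑' j : ℕ, (L ^ j) (G (Z (k + j))) := hZ k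
      _ = L (Z (k + 1)) + G (Z k) := by rw [h2, h1]; abel
  · intro h k
    rw [hZ k]
    simp [h]

end BackwardTrajectory

/-! ### The delay time-`T` map and its reduction to an ordinary differential equation. -/

section BlockOperator

variable {T : ℝ} [hT : Fact (0 < T)] {F : Type*} [NormedAddCommGroup F] [NormedSpace ℂ F]

/-- The embedding of vectors as constant functions. -/
noncomputable def constCLM (T : ℝ) [Fact (0 < T)] (F : Type*) [NormedAddCommGroup F]
    [NormedSpace ℂ F] : F →L[ℂ] C(Icc (0 : ℝ) T, F) :=
  LinearMap.mkContinuous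
    { toFun := fun v => ContinuousMap.const _ v
      map_add' := fun _ _ => rfl
      map_smul' := fun _ _ => rfl } 1 (fun v => by
    refine (ContinuousMap.norm_le _ (by positivity)).2 fun t => ?_
    exact (one_mul ‖v‖).ge)

@[simp] theorem constCLM_apply (v : F) (t : Icc (0 : ℝ) T) : constCLM T F v t = v := rfl

theorem mulOp_add_smul (M C : C(Icc (0 : ℝ) T, F →L[ℂ] F)) (b : ℂ) :
    mulOp (M + b • C) = mulOp M + b • mulOp C := by
  ext f t
  simp

variable [CompleteSpace F]

/-- The time-`T` map of `y' = N y`. -/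
noncomputable def monodromy (N : C(Icc (0 : ℝ) T, F →L[ℂ] F)) : F →L[ℂ] F :=
  ContinuousMap.evalCLM ℂ (rightEnd T) ∘L solOp N ∘L constCLM T F

theorem monodromy_apply (N : C(Icc (0 : ℝ) T, F →L[ℂ] F)) (v : F) :
    monodromy N v = solOp N (constCLM T F v) (rightEnd T) := rfl

/-- The time-`T` map of `y' = M y + C yt`, `yt(t) = (1 - ε) yt(t - T) + ε y(t - T)` on pairs of
history segments. -/
noncomputable def blockOp (M C : C(Icc (0 : ℝ) T, F →L[ℂ] F)) (ε : ℂ) :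
    (C(Icc (0 : ℝ) T, F) × C(Icc (0 : ℝ) T, F)) →L[ℂ]
      (C(Icc (0 : ℝ) T, F) × C(Icc (0 : ℝ) T, F)) :=
  let w := (1 - ε) • ContinuousLinearMap.snd ℂ C(Icc (0 : ℝ) T, F) C(Icc (0 : ℝ) T, F) +
    ε • ContinuousLinearMap.fst ℂ C(Icc (0 : ℝ) T, F) C(Icc (0 : ℝ) T, F)
  (solOp M ∘L (constCLM T F ∘L ContinuousMap.evalCLM ℂ (rightEnd T) ∘L
      ContinuousLinearMap.fst ℂ _ _ + volterra T F ∘L mulOp C ∘L w)).prod w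

theorem blockOp_snd (M C : C(Icc (0 : ℝ) T, F →L[ℂ] F)) (ε : ℂ)
    (z : C(Icc (0 : ℝ) T, F) × C(Icc (0 : ℝ) T, F)) :
    (blockOp M C ε z).2 = (1 - ε) • z.2 + ε • z.1 := rfl

theorem blockOp_fst (M C : C(Icc (0 : ℝ) T, F →L[ℂ] F)) (ε : ℂ)
    (z : C(Icc (0 : ℝ) T, F) × C(Icc (0 : ℝ) T, F)) :
    (blockOp M C ε z).1 = solOp M (constCLM T F (z.1 (rightEnd T)) +
      volterra T F (mulOp C (blockOp M C ε z).2)) := rfl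

/-- The second component of the eigenvalue equation is algebraic, `(l - 1 + ε) yt = ε y`.
Substituting it into the first leaves `y' = (M + bC) y` with `y(T) = l y(0)`. -/
theorem blockOp_eq_smul_of_monodromy (M C : C(Icc (0 : ℝ) T, F →L[ℂ] F)) {ε l : ℂ}
    (hl : l - 1 + ε ≠ 0) {v : F} (hv : monodromy (M + (ε / (l - 1 + ε)) • C) v = l • v) :
    let y := solOp (M + (ε / (l - 1 + ε)) • C) (constCLM T F v)
    blockOp M C ε (y, (ε / (l - 1 + ε)) • y) = l • (y, (ε / (l - 1 + ε)) • y) := by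
  intro y
  set b := ε / (l - 1 + ε) with hb
  have hb' : (1 - ε) * b + ε = l * b := by rw [hb]; field_simp; ring
  have hy : y = constCLM T F v + volterra T F (mulOp (M + b • C) y) := solOp_eq _ _
  rw [mulOp_add_smul, add_apply, smul_apply] at hy
  have h2 : (blockOp M C ε (y, b • y)).2 = (l * b) • y := by
    rw [blockOp_snd, ← hb', add_smul, mul_smul]
  refine Prod.ext ?_ (by rw [h2]; simp [mul_smul])
  rw [blockOp_fst, h2, solOp_eq_iff]
  change l • y = constCLM T F (y (rightEnd T)) + _ + volterra T F (mulOp M (l • y))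
  rw [show y (rightEnd T) = l • v from hv]
  conv_lhs => rw [hy]
  simp only [map_add, map_smul, smul_add, mul_smul]
  abel

/-- The resolvent equation reduces to a boundary value problem for `y`, solvable once `l -
monodromy` is surjective. In finite dimension this follows from injectivity, so only an eigenvalue
can obstruct the resolvent. -/
theorem exists_eigenvector_of_mem_spectrum [FiniteDimensional ℂ F]
    (M C : C(Icc (0 : ℝ) T, F →L[ℂ] F)) {ε l : ℂ} (hl0 : l ≠ 0)
    (hl : l - 1 + ε ≠ 0) (hs : l ∈ spectrum ℂ (blockOp M C ε)) :
    ∃ z, z ≠ 0 ∧ blockOp M C ε z = l • z := by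
  by_contra! hne
  have hinj : ∀ z, blockOp M C ε z = l • z → z = 0 := fun z hz => by
    by_contra h
    exact hne z h hz
  set b := ε / (l - 1 + ε) with hb
  set N := M + b • C with hN
  have hmono : Function.Injective ((l • (1 : F →L[ℂ] F) - monodromy N : F →L[ℂ] F) : F →ₗ[ℂ] F) := by
    rw [injective_iff_map_eq_zero]
    intro v hv
    have hv' : monodromy N v = l • v := by
      have : l • v - monodromy N v = 0 := by simpa using hv
      exact (sub_eq_zero.1 this).symm
    have h := hinj _ (blockOp_eq_smul_of_monodromy M C hl hv')
    have h1 : solOp N (constCLM T F v) = 0 := congrArg Prod.fst h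
    have h2 := solOp_leftEnd N (constCLM T F v)
    rw [h1] at h2
    simpa using h2.symm
  have hsurj := LinearMap.injective_iff_surjective.1 hmono
  refine hs ?_
  rw [spectrum.mem_resolventSet_iff, Algebra.algebraMap_eq_smul_one,
    ContinuousLinearMap.isUnit_iff_bijective]
  have happ : ∀ z, (l • 1 - blockOp M C ε) z = l • z - blockOp M C ε z := fun _ => rfl
  constructor
  · rw [injective_iff_map_eq_zero]
    intro z hz
    rw [happ] at hz
    exact hinj z (sub_eq_zero.1 hz).symm
  · rintro ⟨f₁, f₂⟩
    -- This is what `f₁` and `f₂` contribute to the integral equation for `l • y` once `w` is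
    -- eliminated; the `y`-dependent part is `N`.
    set f := f₁ - volterra T F (mulOp M f₁) +
      volterra T F (mulOp C ((l / (l - 1 + ε)) • f₂ - f₂)) with hf
    -- The vector `c` is the unknown end value `y(T)`, which also sets the initial value `l⁻¹ c`.
    obtain ⟨c, hc⟩ := hsurj (solOp N f (rightEnd T))
    have hc' : l • c = monodromy N c + solOp N f (rightEnd T) := by
      have : l • c - monodromy N c = solOp N f (rightEnd T) := by simpa using hc
      rw [← this]; abel
    set y := solOp N (constCLM T F (l⁻¹ • c) + l⁻¹ • f) with hy
    have hyT : y (rightEnd T) = c := by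
      rw [hy, map_add, map_smul, map_smul, map_smul, ContinuousMap.add_apply,
        ContinuousMap.smul_apply, ContinuousMap.smul_apply, ← monodromy_apply, ← smul_add, ← hc',
        inv_smul_smul₀ hl0]
    have hye : l • y = constCLM T F c + f + l • volterra T F (mulOp N y) := by
      have := solOp_eq N (constCLM T F (l⁻¹ • c) + l⁻¹ • f)
      rw [← hy] at this
      conv_lhs => rw [this]
      rw [map_smul, smul_add, smul_add, smul_inv_smul₀ hl0, smul_inv_smul₀ hl0]
    set w := b • y + (l - 1 + ε)⁻¹ • f₂ with hw
    have hw2 : (1 - ε) • w + ε • y = l • w - f₂ := by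
      have h1 : (1 - ε) * b + ε = l * b := by rw [hb]; field_simp; ring
      have h2 : (1 - ε) * (l - 1 + ε)⁻¹ = l * (l - 1 + ε)⁻¹ - 1 := by field_simp; ring
      have h3 : (1 - ε) • w + ε • y = ((1 - ε) * b + ε) • y + ((1 - ε) * (l - 1 + ε)⁻¹) • f₂ := by
        rw [hw]; module
      rw [h3, h1, h2, hw]
      module
    refine ⟨(y, w), ?_⟩
    rw [happ]
    have h2 : (blockOp M C ε (y, w)).2 = l • w - f₂ := by rw [blockOp_snd, hw2]
    have h1 : (blockOp M C ε (y, w)).1 = l • y - f₁ := by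
      rw [blockOp_fst, h2, solOp_eq_iff]
      change _ = constCLM T F (y (rightEnd T)) + _ + _
      rw [hyT]
      conv_lhs => rw [hye]
      rw [hf, hN, mulOp_add_smul, hw]
      simp only [map_add, map_smul, map_sub, smul_add, add_apply, smul_apply, smul_smul,
        div_eq_mul_inv]
      abel
    exact Prod.ext (by simp [h1]) (by simp [h2])

end BlockOperator

/-! ### Growth of powers from Gelfand's formula. -/

section SpectralGrowth

open Filter Topology ENNReal

/-- If the spectral radius exceeds `1`, it is attained by a spectral value `l`, and
`∑ ‖a ^ j‖ ‖l‖ ^ (-2 j)` converges. -/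
theorem exists_mem_spectrum_summable {A : Type*} [NormedRing A] [NormedAlgebra ℂ A]
    [CompleteSpace A] [Nontrivial A] (a : A) {l₀ : ℂ} (hl₀ : l₀ ∈ spectrum ℂ a) (h1 : 1 < ‖l₀‖) :
    ∃ l ∈ spectrum ℂ a, 1 < ‖l‖ ∧ Summable fun j : ℕ => ‖a ^ j‖ * (‖l‖⁻¹ ^ 2) ^ j := by
  obtain ⟨l, hl, hr⟩ := spectrum.exists_nnnorm_eq_spectralRadius a
  have hle : ‖l₀‖ ≤ ‖l‖ := by
    have : (‖l₀‖₊ : ℝ≥0∞) ≤ spectralRadius ℂ a :=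
      le_iSup₂ (f := fun (k : ℂ) (_ : k ∈ spectrum ℂ a) => (‖k‖₊ : ℝ≥0∞)) l₀ hl₀
    rw [← hr] at this
    exact_mod_cast this
  have hl1 : 1 < ‖l‖ := h1.trans_le hle
  refine ⟨l, hl, hl1, ?_⟩
  set ρ := ‖l‖ with hρ
  -- Any number strictly between the spectral radius `ρ` and `ρ ^ 2` would do; one exists because `ρ
  -- > 1`.
  set r := (ρ + ρ ^ 2) / 2 with hrdef
  have hρr : ρ < r := by rw [hrdef]; nlinarith
  have hrρ : r < ρ ^ 2 := by rw [hrdef]; nlinarith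
  have hev : ∀ᶠ n : ℕ in atTop, ENNReal.ofReal (‖a ^ n‖ ^ (1 / n : ℝ)) < ENNReal.ofReal r := by
    refine (spectrum.pow_norm_pow_one_div_tendsto_nhds_spectralRadius a).eventually
      (gt_mem_nhds ?_)
    rw [← hr, show (‖l‖₊ : ℝ≥0∞) = ENNReal.ofReal ρ from (ofReal_norm l).symm]
    exact (ENNReal.ofReal_lt_ofReal_iff (by linarith)).2 hρr
  refine Summable.of_norm_bounded_eventually_nat (g := fun j => (r / ρ ^ 2) ^ j)
    (summable_geometric_of_lt_one (by positivity) ((div_lt_one (by positivity)).2 hrρ)) ?_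
  filter_upwards [hev, eventually_gt_atTop 0] with n hn hn0
  have h2 : ‖a ^ n‖ ^ (1 / n : ℝ) ≤ r :=
    ((ENNReal.ofReal_lt_ofReal_iff (by linarith)).1 hn).le
  have h3 : ‖a ^ n‖ ≤ r ^ n := by
    have := pow_le_pow_left₀ (by positivity) h2 n
    rwa [one_div, Real.rpow_inv_natCast_pow (norm_nonneg _) hn0.ne'] at this
  rw [Real.norm_of_nonneg (by positivity), div_pow, inv_pow, inv_pow, ← div_eq_mul_inv]
  gcongr

end SpectralGrowth

/-! ### Passage from complex eigenvectors to real trajectories. -/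

section RealTrajectory

open Filter Topology

variable {X : Type*} [NormedAddCommGroup X] [NormedSpace ℂ X] [CompleteSpace X]

/-- If the spectral values of `L` outside the unit disc are eigenvalues and there is one, then the
perturbation of `L` by a quadratically small nonlinearity has a nontrivial trajectory in the real
subspace `{z | P z = z}` that converges to `0` backward in time. -/
theorem exists_real_backward_trajectory (L : X →L[ℂ] X) {l₀ : ℂ} (hl₀ : l₀ ∈ spectrum ℂ L)
    (h1 : 1 < ‖l₀‖) (heig : ∀ l ∈ spectrum ℂ L, 1 < ‖l‖ → ∃ z, z ≠ 0 ∧ L z = l • z)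
    {P : X → X} (hPn : ∀ z, ‖P z‖ ≤ ‖z‖) (hPadd : ∀ z z', P (z + z') = P z + P z')
    (hPsmul : ∀ (a : ℝ) z, P ((a : ℂ) • z) = (a : ℂ) • P z) (hPP : ∀ z, P (P z) = P z)
    (hPI : ∀ z, P z = 0 → P (Complex.I • z) = 0 → z = 0) (hPL : ∀ z, L (P z) = P (L z))
    {G : X → X} (hG0 : G 0 = 0) {c : ℝ} (hc : 0 ≤ c)
    (hG : ∀ a b, ‖a‖ ≤ 1 → ‖b‖ ≤ 1 → ‖G a - G b‖ ≤ c * (‖a‖ + ‖b‖) * ‖a - b‖)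
    (hGP : ∀ z, G (P z) = G z) (hPG : ∀ z, P (G z) = G z) :
    ∃ Z : ℕ → X, Tendsto Z atTop (𝓝 0) ∧ (∀ k, P (Z k) = Z k) ∧
      (∀ k, Z k = L (Z (k + 1)) + G (Z k)) ∧ ∃ k, Z k ≠ 0 := by
  have hnt : Nontrivial X := by
    by_contra h
    rw [not_nontrivial_iff_subsingleton] at h
    exact hl₀ ((ContinuousLinearMap.isUnit_iff_bijective).2
      ⟨fun a b _ => Subsingleton.elim _ _, fun b => ⟨0, Subsingleton.elim _ _⟩⟩)
  obtain ⟨l, hl, hl1, hsum⟩ := exists_mem_spectrum_summable L hl₀ h1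
  have hl0 : l ≠ 0 := by rintro rfl; norm_num at hl1
  obtain ⟨z₀, hz₀, hLz₀⟩ := heig l hl hl1
  -- If the real part of an eigenvector vanishes, that of its multiple by `I` does not.
  obtain ⟨z, hPz, hLz⟩ : ∃ z, P z ≠ 0 ∧ L z = l • z := by
    by_cases h : P z₀ = 0
    · exact ⟨Complex.I • z₀, fun h' => hz₀ (hPI _ h h'), by rw [map_smul, hLz₀, smul_comm]⟩
    · exact ⟨z₀, h, hLz₀⟩
  let v : ℕ → X := fun k => P (l⁻¹ ^ k • z)
  have hv : ∀ k, L (v (k + 1)) = v k := fun k => by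
    simp only [v]
    rw [hPL, map_smul, hLz, smul_smul, pow_succ, mul_assoc, inv_mul_cancel₀ hl0, mul_one]
  have hvb : ∀ k, ‖v k‖ ≤ ‖z‖ * ‖l‖⁻¹ ^ k := fun k => by
    refine (hPn _).trans ?_
    rw [norm_smul, norm_pow, norm_inv, mul_comm]
  have hpow : ∀ j : ℕ, (L.restrictScalars ℝ) ^ j = (L ^ j).restrictScalars ℝ := fun j => by
    induction j with
    | zero => rfl
    | succ j ih => rw [pow_succ, ih, pow_succ]; rfl
  have hsum' : Summable fun j : ℕ => ‖(L.restrictScalars ℝ) ^ j‖ * (‖l‖⁻¹ ^ 2) ^ j := by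
    refine hsum.congr fun j => ?_
    rw [hpow, ContinuousLinearMap.norm_restrictScalars]
  obtain ⟨Z, hZt, hZ, a, ha, hZ0⟩ := exists_backward_trajectory (L.restrictScalars ℝ)
    (by positivity : 0 < ‖l‖⁻¹) (inv_lt_one_of_one_lt₀ hl1) hsum' hv hvb hG0 hc hG
  refine ⟨fun k => P (Z k), squeeze_zero_norm (fun k => hPn (Z k)) (by simpa using hZt.norm),
    fun k => hPP _, fun k => ?_, ?_⟩
  · refine (congrArg P (hZ k)).trans ?_
    rw [hPadd, hPG, hGP, hPL]; rfl
  -- If every real part vanished, `G` would vanish along `Z`, so `Z` would be the linear trajectory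
  -- `a • v`, whose real part at `k = 0` is nonzero.
  · by_contra! hcon
    have h2 := hZ0 (fun k => by rw [← hGP, hcon k, hG0]) 0
    have h3 := hcon 0
    rw [h2, ← Complex.coe_smul, hPsmul, show v 0 = P z by simp [v], hPP] at h3
    exact (smul_ne_zero (by exact_mod_cast ha) hPz) h3

end RealTrajectory

/-! ### Backward trajectories of the nonlinear delay system, block by block. -/

section DelayTrajectory

open Filter Topology MeasureTheory

variable {T : ℝ} [hT : Fact (0 < T)] {F : Type*} [NormedAddCommGroup F] [NormedSpace ℂ F]

/-- Pointwise application of a real-linear map. -/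
noncomputable def realOp (R : F →L[ℝ] F) (f : C(Icc (0 : ℝ) T, F)) : C(Icc (0 : ℝ) T, F) :=
  ⟨fun t => R (f t), by fun_prop⟩

@[simp] theorem realOp_apply (R : F →L[ℝ] F) (f : C(Icc (0 : ℝ) T, F)) (t : Icc (0 : ℝ) T) :
    realOp R f t = R (f t) := rfl

theorem realOp_add (R : F →L[ℝ] F) (f g : C(Icc (0 : ℝ) T, F)) :
    realOp R (f + g) = realOp R f + realOp R g := by ext; simp

theorem realOp_smul (R : F →L[ℝ] F) (a : ℝ) (f : C(Icc (0 : ℝ) T, F)) :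
    realOp R ((a : ℂ) • f) = (a : ℂ) • realOp R f := by
  ext t
  simp only [realOp_apply, ContinuousMap.smul_apply]
  rw [Complex.coe_smul, map_smul, Complex.coe_smul]

theorem realOp_constCLM (R : F →L[ℝ] F) (v : F) :
    realOp R (constCLM T F v) = constCLM T F (R v) := rfl

theorem norm_realOp_le {R : F →L[ℝ] F} (hR : ∀ a, ‖R a‖ ≤ ‖a‖) (f : C(Icc (0 : ℝ) T, F)) :
    ‖realOp R f‖ ≤ ‖f‖ :=
  (ContinuousMap.norm_le _ (norm_nonneg _)).2 fun t => (hR _).trans (f.norm_coe_le_norm t)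

theorem realOp_mulOp {R : F →L[ℝ] F} {N : C(Icc (0 : ℝ) T, F →L[ℂ] F)}
    (hN : ∀ t a, R (N t a) = N t (R a)) (f : C(Icc (0 : ℝ) T, F)) :
    realOp R (mulOp N f) = mulOp N (realOp R f) := by
  ext t
  exact hN t _

variable [CompleteSpace F]

theorem realOp_volterra (R : F →L[ℝ] F) (f : C(Icc (0 : ℝ) T, F)) :
    realOp R (volterra T F f) = volterra T F (realOp R f) := by
  ext t
  have := R.intervalIntegral_comp_comm
    ((continuous_extend f).intervalIntegrable (μ := volume) 0 (t : ℝ))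
  exact this.symm

theorem realOp_solOp {R : F →L[ℝ] F} {N : C(Icc (0 : ℝ) T, F →L[ℂ] F)}
    (hN : ∀ t a, R (N t a) = N t (R a)) (f : C(Icc (0 : ℝ) T, F)) :
    realOp R (solOp N f) = solOp N (realOp R f) := by
  symm
  rw [solOp_eq_iff]
  conv_lhs => rw [solOp_eq]
  rw [realOp_add, realOp_volterra, realOp_mulOp hN]

theorem realOp_blockOp {R : F →L[ℝ] F} {M C : C(Icc (0 : ℝ) T, F →L[ℂ] F)}
    (hM : ∀ t a, R (M t a) = M t (R a)) (hC : ∀ t a, R (C t a) = C t (R a)) (ε : ℝ)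
    (z : C(Icc (0 : ℝ) T, F) × C(Icc (0 : ℝ) T, F)) :
    blockOp M C ε (realOp R z.1, realOp R z.2) =
      (realOp R (blockOp M C ε z).1, realOp R (blockOp M C ε z).2) := by
  have h2 : (blockOp M C ε (realOp R z.1, realOp R z.2)).2 = realOp R (blockOp M C ε z).2 := by
    have := realOp_smul R (1 - ε) z.2
    push_cast at this
    rw [blockOp_snd, blockOp_snd, realOp_add, realOp_smul, this]
  refine Prod.ext ?_ h2
  rw [blockOp_fst, h2]
  simp only
  rw [blockOp_fst, realOp_solOp hM, realOp_add, realOp_volterra, realOp_mulOp hC, realOp_constCLM]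
  rfl

/-- Iteration gives `u k = c ^ j • u (k + j)`, a bounded factor times a null sequence. With `c = 1 -
ε` it excludes backward decay of the pure recursion mode. -/
theorem eq_zero_of_eq_smul_succ {Y : Type*} [NormedAddCommGroup Y] [NormedSpace ℂ Y] {c : ℂ}
    (hc : ‖c‖ ≤ 1) {u : ℕ → Y} (hu : ∀ k, u k = c • u (k + 1)) (ht : Tendsto u atTop (𝓝 0))
    (k : ℕ) : u k = 0 := by
  have hk : ∀ j, u k = c ^ j • u (k + j) := fun j => by
    induction j with
    | zero => simp
    | succ j ih => rw [ih, hu (k + j), smul_smul, pow_succ, add_assoc]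
  have h : Tendsto (fun j => c ^ j • u (k + j)) atTop (𝓝 0) := by
    refine squeeze_zero_norm (a := fun j => ‖u (k + j)‖) (fun j => ?_) ?_
    · rw [norm_smul, norm_pow]
      exact mul_le_of_le_one_left (norm_nonneg _) (pow_le_one₀ (norm_nonneg _) hc)
    · simpa [add_comm k] using ((tendsto_add_atTop_iff_nat k).2 ht).norm
  refine tendsto_nhds_unique ?_ h
  simp only [← hk]
  exact tendsto_const_nhds

/-- A delay system whose linear part has a spectral value outside the unit disc has a nontrivial
real trajectory, given block by block, that converges to `0` backward in time. -/
theorem exists_delay_trajectory [FiniteDimensional ℂ F] (M C : C(Icc (0 : ℝ) T, F →L[ℂ] F))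
    {ε : ℝ} (hε0 : 0 < ε) (hε1 : ε < 1) {R : F →L[ℝ] F} (hR : ∀ a, ‖R a‖ ≤ ‖a‖)
    (hRR : ∀ a, R (R a) = R a) (hRI : ∀ a, R a = 0 → R (Complex.I • a) = 0 → a = 0)
    (hM : ∀ t a, R (M t a) = M t (R a)) (hC : ∀ t a, R (C t a) = C t (R a))
    (g : C(F, F)) (hg0 : g 0 = 0) {c : ℝ} (hc : 0 ≤ c)
    (hg : ∀ a b, ‖a‖ ≤ 1 → ‖b‖ ≤ 1 → ‖g a - g b‖ ≤ c * (‖a‖ + ‖b‖) * ‖a - b‖)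
    (hgR : ∀ a, R (g (R a)) = g (R a)) {l₀ : ℂ} (hl₀ : l₀ ∈ spectrum ℂ (blockOp M C (ε : ℂ)))
    (h1 : 1 < ‖l₀‖) :
    ∃ y w : ℕ → C(Icc (0 : ℝ) T, F), Tendsto y atTop (𝓝 0) ∧ Tendsto w atTop (𝓝 0) ∧
      (∀ k, y k = constCLM T F (y (k + 1) (rightEnd T)) +
        volterra T F (mulOp M (y k) + mulOp C (w k) + g.comp (y k))) ∧
      (∀ k, w k = (1 - ε : ℂ) • w (k + 1) + (ε : ℂ) • y (k + 1)) ∧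
      (∀ k t, R (y k t) = y k t) ∧ (∀ k t, R (w k t) = w k t) ∧ ∃ k t, y k t ≠ y (k + 1) t := by
  let X := C(Icc (0 : ℝ) T, F) × C(Icc (0 : ℝ) T, F)
  set L : X →L[ℂ] X := blockOp M C (ε : ℂ) with hL
  have heig : ∀ l ∈ spectrum ℂ L, 1 < ‖l‖ → ∃ z, z ≠ 0 ∧ L z = l • z := fun l hl hl1 => by
    refine exists_eigenvector_of_mem_spectrum M C ?_ ?_ hl
    · rintro rfl; norm_num at hl1
    · intro h
      have : l = ((1 - ε : ℝ) : ℂ) := by push_cast; linear_combination h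
      rw [this, Complex.norm_real, Real.norm_of_nonneg (by linarith)] at hl1
      linarith
  let P : X → X := fun z => (realOp R z.1, realOp R z.2)
  have hPn : ∀ z, ‖P z‖ ≤ ‖z‖ := fun z =>
    max_le_max (norm_realOp_le hR z.1) (norm_realOp_le hR z.2)
  have hPL : ∀ z, L (P z) = P (L z) := fun z => realOp_blockOp hM hC ε z
  have hPI : ∀ z, P z = 0 → P (Complex.I • z) = 0 → z = 0 := fun z h h' => by
    have h1 := congrArg Prod.fst h
    have h2 := congrArg Prod.snd h
    have h1' := congrArg Prod.fst h'
    have h2' := congrArg Prod.snd h'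
    refine Prod.ext ?_ ?_
    · ext t
      exact hRI _ (DFunLike.congr_fun h1 t) (DFunLike.congr_fun h1' t)
    · ext t
      exact hRI _ (DFunLike.congr_fun h2 t) (DFunLike.congr_fun h2' t)
  let Q : C(Icc (0 : ℝ) T, F) →L[ℂ] C(Icc (0 : ℝ) T, F) := solOp M ∘L volterra T F
  -- The nonlinearity acts on the block being computed, so it enters as `G (Z k)` and not as `G (Z
  -- (k + 1))`. The implicit form avoids solving a nonlinear initial value problem. The inner real
  -- part makes `G` see only the projection of `z`.
  let G : X → X := fun z => (Q (g.comp (realOp R z.1)), 0)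
  have hG0 : G 0 = 0 := by
    refine Prod.ext ?_ rfl
    have : g.comp (realOp R (0 : X).1) = 0 := by ext t; simp [hg0]
    simp only [G]
    rw [this, map_zero]; rfl
  have hGq : ∀ a b, ‖a‖ ≤ 1 → ‖b‖ ≤ 1 →
      ‖G a - G b‖ ≤ ‖Q‖ * c * (‖a‖ + ‖b‖) * ‖a - b‖ := by
    intro a b ha hb
    have hpt : ∀ (a : X) t, ‖R (a.1 t)‖ ≤ ‖a‖ := fun a t =>
      (hR _).trans ((a.1.norm_coe_le_norm t).trans (norm_fst_le a))
    have h0 : ‖G a - G b‖ = ‖Q (g.comp (realOp R a.1) - g.comp (realOp R b.1))‖ := by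
      rw [map_sub]
      have : G a - G b = (Q (g.comp (realOp R a.1)) - Q (g.comp (realOp R b.1)), 0) :=
        Prod.ext rfl (sub_zero _)
      rw [this, Prod.norm_mk, norm_zero, max_eq_left (norm_nonneg _)]
    rw [h0, mul_assoc, mul_assoc]
    refine (Q.le_opNorm _).trans (mul_le_mul_of_nonneg_left ?_ (norm_nonneg _))
    refine (ContinuousMap.norm_le _ (by positivity)).2 fun t => ?_
    refine (hg _ _ ((hpt a t).trans ha) ((hpt b t).trans hb)).trans ?_
    rw [mul_assoc]
    refine mul_le_mul_of_nonneg_left ?_ hc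
    refine mul_le_mul (add_le_add (hpt a t) (hpt b t)) ?_ (norm_nonneg _) (by positivity)
    have := hpt (a - b) t
    rwa [Prod.fst_sub, ContinuousMap.sub_apply, map_sub] at this
  have hPP : ∀ z, P (P z) = P z := fun z => Prod.ext
    (ContinuousMap.ext fun t => hRR _) (ContinuousMap.ext fun t => hRR _)
  have hPG : ∀ z, P (G z) = G z := fun z => by
    refine Prod.ext ?_ ?_
    · simp only [P, G, Q, ContinuousLinearMap.comp_apply]
      rw [realOp_solOp hM, realOp_volterra]
      congr 2
      ext t
      exact hgR _
    · ext t; simp [P, G]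
  have hGP : ∀ z, G (P z) = G z := fun z => by
    have : realOp R (realOp R z.1) = realOp R z.1 := congrArg Prod.fst (hPP z)
    simp only [G, P, this]
  have hPadd : ∀ z z', P (z + z') = P z + P z' := fun z z' =>
    Prod.ext (realOp_add _ _ _) (realOp_add _ _ _)
  have hPsmul : ∀ (a : ℝ) z, P ((a : ℂ) • z) = (a : ℂ) • P z := fun a z =>
    Prod.ext (realOp_smul R a z.1) (realOp_smul R a z.2)
  obtain ⟨Z, hZt, hPZ, hZ, hZ0⟩ := exists_real_backward_trajectory L hl₀ h1 heig hPn hPadd hPsmul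
    hPP hPI hPL hG0 (by positivity) hGq hGP hPG
  have hw : ∀ k, (Z k).2 = (1 - ε : ℂ) • (Z (k + 1)).2 + (ε : ℂ) • (Z (k + 1)).1 :=
    fun k => by
      have := congrArg Prod.snd (hZ k)
      rwa [Prod.snd_add, blockOp_snd, show (G (Z k)).2 = 0 from rfl, add_zero] at this
  have hw' : ∀ k, (L (Z (k + 1))).2 = (Z k).2 := fun k => by
    rw [hw k, blockOp_snd]
  have ht1 : Tendsto (fun k => (Z k).1) atTop (𝓝 0) := (continuous_fst.tendsto _).comp hZt
  have ht2 : Tendsto (fun k => (Z k).2) atTop (𝓝 0) := (continuous_snd.tendsto _).comp hZt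
  have hR1 : ∀ k, realOp R (Z k).1 = (Z k).1 := fun k => congrArg Prod.fst (hPZ k)
  refine ⟨fun k => (Z k).1, fun k => (Z k).2, ht1, ht2, fun k => ?_, hw,
    fun k => DFunLike.congr_fun (hR1 k),
    fun k => DFunLike.congr_fun (congrArg Prod.snd (hPZ k)), ?_⟩
  · have h := congrArg Prod.fst (hZ k)
    rw [Prod.fst_add, blockOp_fst, hw' k] at h
    have hG1 : (G (Z k)).1 = solOp M (volterra T F (g.comp (Z k).1)) := by
      simp only [G, Q, ContinuousLinearMap.comp_apply, hR1]
    rw [hG1, ← map_add] at h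
    refine ((solOp_eq_iff _ _ _).1 h.symm).trans ?_
    simp only [map_add]
    abel
  -- If consecutive `y`-blocks agreed, all would equal their limit `0`. Then `w` satisfies `w k = (1
  -- - ε) w (k + 1)` and vanishes as well, contradicting `hZ0`.
  · by_contra! hcon
    have hy : ∀ k, (Z k).1 = 0 := fun k => by
      have hk : ∀ j, (Z (k + j)).1 = (Z k).1 := fun j => by
        induction j with
        | zero => rfl
        | succ j ih => rw [← ih]; ext t; exact (hcon (k + j) t).symm
      have := (tendsto_add_atTop_iff_nat k).2 ht1
      refine tendsto_nhds_unique ?_ this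
      simp only [add_comm _ k, hk]
      exact tendsto_const_nhds
    obtain ⟨k, hk⟩ := hZ0
    refine hk (Prod.ext (hy k) ?_)
    refine eq_zero_of_eq_smul_succ (c := (1 - ε : ℂ)) ?_ (u := fun k => (Z k).2) ?_ ht2 k
    · rw [show (1 - ε : ℂ) = ((1 - ε : ℝ) : ℂ) by push_cast; rfl, Complex.norm_real,
        Real.norm_of_nonneg (by linarith)]
      linarith
    · intro k
      simpa [hy] using hw k

end DelayTrajectory

/-! ### Gluing the blocks into a solution on a half-line. -/

section Gluing

open Filter Topology

variable {T : ℝ} [hT : Fact (0 < T)] {F : Type*} [NormedAddCommGroup F] [NormedSpace ℂ F]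

/-- The function on `(-∞, T]` that is given on `[-k T, -k T + T]` by the block `y k`. -/
noncomputable def glue (y : ℕ → C(Icc (0 : ℝ) T, F)) (t : ℝ) : F :=
  IccExtend hT.out.le (y (-⌊t / T⌋).toNat) (t + (-⌊t / T⌋).toNat * T)

/-- The floor assigns the right end point of a block to its later neighbour, so the matching
condition is needed exactly there. -/
theorem glue_eq {y : ℕ → C(Icc (0 : ℝ) T, F)}
    (hy : ∀ k, y (k + 1) (rightEnd T) = y k (leftEnd T)) (k : ℕ) {t : ℝ}
    (ht : t ∈ Icc (-(k * T)) (-(k * T) + T)) :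
    glue y t = IccExtend hT.out.le (y k) (t + k * T) := by
  have h0 := hT.out
  rcases ht.2.lt_or_eq with h | h
  · have : ⌊t / T⌋ = -(k : ℤ) := by
      rw [Int.floor_eq_iff]
      push_cast
      constructor
      · rw [le_div_iff₀ h0]; linarith [ht.1]
      · rw [div_lt_iff₀ h0]; linarith
    simp [glue, this]
  · have hfl : ⌊t / T⌋ = 1 - (k : ℤ) := by
      rw [h, show (-(k * T) + T) / T = ((1 - (k : ℤ) : ℤ) : ℝ) by push_cast; field_simp; ring,
        Int.floor_intCast]
    cases k with
    -- At `t = T` the floor is `1`, and the truncation in `toNat` still selects block `0`.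
    | zero => simp [glue, hfl]
    | succ k =>
      have h1 : (-⌊t / T⌋).toNat = k := by rw [hfl]; omega
      rw [glue, h1, show t + k * T = 0 by rw [h]; push_cast; ring,
        show t + (k + 1 : ℕ) * T = T by rw [h]; push_cast; ring, IccExtend_left, IccExtend_right]
      exact (hy k).symm

theorem exists_block (T : ℝ) [hT : Fact (0 < T)] {t : ℝ} (ht : t ≤ T) :
    ∃ k : ℕ, t ∈ Icc (-(k * T)) (-(k * T) + T) := by
  have h0 := hT.out
  rcases ht.lt_or_eq with h | h
  · have h1 : ⌊t / T⌋ ≤ 0 := by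
      rw [← Int.lt_add_one_iff, Int.floor_lt, div_lt_iff₀ h0]; push_cast; linarith
    obtain ⟨k, hk⟩ := Int.eq_ofNat_of_zero_le (neg_nonneg.2 h1)
    have hk' : ⌊t / T⌋ = -(k : ℤ) := by linarith
    rw [Int.floor_eq_iff] at hk'
    push_cast at hk'
    rw [le_div_iff₀ h0, div_lt_iff₀ h0] at hk'
    exact ⟨k, by linarith, by linarith⟩
  · exact ⟨0, by simpa [h] using h0.le⟩

theorem Icc_neg_succ_mul (T : ℝ) [hT : Fact (0 < T)] (k : ℕ) :
    Icc (-((k + 1 : ℕ) * T)) T =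
      Icc (-((k + 1 : ℕ) * T)) (-((k + 1 : ℕ) * T) + T) ∪ Icc (-(k * T)) T := by
  have h0 := hT.out
  have h1 : -((k + 1 : ℕ) * T) + T = -(k * T) := by push_cast; ring
  have h2 : (0 : ℝ) ≤ k * T := by positivity
  rw [h1, Icc_union_Icc_eq_Icc (by linarith) (by linarith)]

theorem continuousOn_glue {y : ℕ → C(Icc (0 : ℝ) T, F)}
    (hy : ∀ k, y (k + 1) (rightEnd T) = y k (leftEnd T)) (k : ℕ) :
    ContinuousOn (glue y) (Icc (-(k * T)) T) := by
  have hb : ∀ k : ℕ, ContinuousOn (glue y) (Icc (-(k * T)) (-(k * T) + T)) := fun k => by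
    have h : Continuous fun t => IccExtend hT.out.le (y k) (t + k * T) :=
      (continuous_extend (y k)).comp (by fun_prop)
    exact h.continuousOn.congr fun t ht => glue_eq hy k ht
  induction k with
  | zero => simpa using hb 0
  | succ k ih =>
    rw [Icc_neg_succ_mul]
    exact (hb (k + 1)).union_of_isClosed ih isClosed_Icc isClosed_Icc

/-- Off a closed set the derivative within it holds vacuously, so each piece matters only at its own
points. At a junction both one-sided derivatives equal the same `f`. -/
theorem hasDerivWithinAt_union_of_isClosed {u : ℝ → F} {f : F} {s s' : Set ℝ} {t : ℝ}
    (hs : IsClosed s) (hs' : IsClosed s') (h : t ∈ s → HasDerivWithinAt u f s t)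
    (h' : t ∈ s' → HasDerivWithinAt u f s' t) : HasDerivWithinAt u f (s ∪ s') t := by
  have key : ∀ {s : Set ℝ}, IsClosed s → (t ∈ s → HasDerivWithinAt u f s t) →
      HasDerivWithinAt u f s t := fun {s} hs h => by
    by_cases ht : t ∈ s
    · exact h ht
    · exact HasFDerivWithinAt.of_notMem_closure (by rwa [hs.closure_eq])
  exact (key hs h).union (key hs' h')

theorem hasDerivWithinAt_glue {y : ℕ → C(Icc (0 : ℝ) T, F)}
    (hy : ∀ k, y (k + 1) (rightEnd T) = y k (leftEnd T)) {f : ℝ → F}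
    (hf : ∀ (k : ℕ) (t : Icc (0 : ℝ) T),
      HasDerivWithinAt (IccExtend hT.out.le (y k)) (f (t - k * T)) (Icc 0 T) t)
    (k : ℕ) {t : ℝ} (ht : t ∈ Icc (-(k * T)) T) :
    HasDerivWithinAt (glue y) (f t) (Icc (-(k * T)) T) t := by
  have hb : ∀ (k : ℕ) (t : ℝ), t ∈ Icc (-(k * T)) (-(k * T) + T) →
      HasDerivWithinAt (glue y) (f t) (Icc (-(k * T)) (-(k * T) + T)) t := fun k t ht => by
    have hm : t + k * T ∈ Icc (0 : ℝ) T := ⟨by linarith [ht.1], by linarith [ht.2]⟩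
    have h := hf k ⟨t + k * T, hm⟩
    rw [show t + k * T - k * T = t by ring] at h
    have h2 : HasDerivWithinAt (fun t : ℝ => t + k * T) 1 (Icc (-(k * T)) (-(k * T) + T)) t :=
      ((hasDerivAt_id t).add_const _).hasDerivWithinAt
    have hmaps : MapsTo (fun t : ℝ => t + k * T) (Icc (-(k * T)) (-(k * T) + T)) (Icc 0 T) :=
      fun s hs => ⟨by linarith [hs.1], by linarith [hs.2]⟩
    have h3 := HasDerivWithinAt.scomp t h h2 hmaps
    rw [one_smul] at h3
    exact h3.congr (fun s hs => glue_eq hy k hs) (glue_eq hy k ht)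
  induction k with
  | zero => simpa using hb 0 t (by simpa using ht)
  | succ k ih =>
    rw [Icc_neg_succ_mul]
    exact hasDerivWithinAt_union_of_isClosed isClosed_Icc isClosed_Icc (hb (k + 1) t) ih

variable [CompleteSpace F]

theorem hasDerivWithinAt_of_eq_volterra {y f : C(Icc (0 : ℝ) T, F)} {v : F}
    (hy : y = constCLM T F v + volterra T F f) (t : Icc (0 : ℝ) T) :
    HasDerivWithinAt (IccExtend hT.out.le y) (f t) (Icc 0 T) t := by
  have h := (hasDerivWithinAt_volterra f t).const_add v
  refine h.congr (fun s hs => ?_) ?_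
  · rw [hy, IccExtend_of_mem _ _ hs, IccExtend_of_mem _ _ hs]; rfl
  · rw [hy, IccExtend_of_mem _ _ t.2, IccExtend_of_mem _ _ t.2]; rfl

/-- The trajectory of `exists_delay_trajectory` as a solution of the delay system on
`(-∞, T]`. -/
theorem exists_delay_solution [FiniteDimensional ℂ F] {M C : ℝ → F →L[ℂ] F}
    (hMc : Continuous M) (hCc : Continuous C) (hMT : Function.Periodic M T)
    (hCT : Function.Periodic C T)
    {ε : ℝ} (hε0 : 0 < ε) (hε1 : ε < 1) {R : F →L[ℝ] F} (hR : ∀ a, ‖R a‖ ≤ ‖a‖)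
    (hRR : ∀ a, R (R a) = R a) (hRI : ∀ a, R a = 0 → R (Complex.I • a) = 0 → a = 0)
    (hM : ∀ t a, R (M t a) = M t (R a)) (hC : ∀ t a, R (C t a) = C t (R a))
    (g : C(F, F)) (hg0 : g 0 = 0) {c : ℝ} (hc : 0 ≤ c)
    (hg : ∀ a b, ‖a‖ ≤ 1 → ‖b‖ ≤ 1 → ‖g a - g b‖ ≤ c * (‖a‖ + ‖b‖) * ‖a - b‖)
    (hgR : ∀ a, R (g (R a)) = g (R a)) {l₀ : ℂ}
    (hl₀ : l₀ ∈ spectrum ℂ (blockOp (T := T) ⟨fun t => M t, by fun_prop⟩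
      ⟨fun t => C t, by fun_prop⟩ (ε : ℂ))) (h1 : 1 < ‖l₀‖) :
    ∃ Y W : ℝ → F, (∀ k : ℕ, ContinuousOn Y (Icc (-(k * T)) T)) ∧
      (∀ k : ℕ, ContinuousOn W (Icc (-(k * T)) T)) ∧
      (∀ (k : ℕ), ∀ t ∈ Icc (-(k * T)) T,
        HasDerivWithinAt Y (M t (Y t) + C t (W t) + g (Y t)) (Icc (-(k * T)) T) t) ∧
      (∀ t ≤ T, W t = (1 - ε : ℂ) • W (t - T) + (ε : ℂ) • Y (t - T)) ∧
      (∀ t, R (Y t) = Y t) ∧ (∀ t, R (W t) = W t) ∧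
      (∀ δ > 0, ∃ t₀, ∀ t ≤ t₀, ‖Y t‖ < δ ∧ ‖W t‖ < δ) ∧
      ∃ t ≤ T, Y t ≠ Y (t - T) := by
  have h0 := hT.out
  obtain ⟨y, w, hyt, hwt, hy, hw, hRy, hRw, k₀, s₀, hne⟩ := exists_delay_trajectory
    (T := T) ⟨fun t => M t, by fun_prop⟩ ⟨fun t => C t, by fun_prop⟩ hε0 hε1 hR hRR hRI
    (fun t => hM t) (fun t => hC t) g hg0 hc hg hgR hl₀ h1
  have hym : ∀ k, y (k + 1) (rightEnd T) = y k (leftEnd T) := fun k => by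
    have h := DFunLike.congr_fun (hy k) (leftEnd T)
    rw [ContinuousMap.add_apply, volterra_leftEnd, add_zero, constCLM_apply] at h
    exact h.symm
  -- The space of pairs of blocks does not impose the compatibility condition on the reference. The
  -- mismatch at the junctions is multiplied by `1 - ε` in each step forward and tends to zero
  -- backward in time, hence it vanishes.
  have hwm : ∀ k, w (k + 1) (rightEnd T) = w k (leftEnd T) := fun k => by
    refine sub_eq_zero.1 (eq_zero_of_eq_smul_succ (c := (1 - ε : ℂ)) ?_
      (u := fun k => w (k + 1) (rightEnd T) - w k (leftEnd T)) (fun k => ?_) ?_ k)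
    · rw [show (1 - ε : ℂ) = ((1 - ε : ℝ) : ℂ) by push_cast; rfl, Complex.norm_real,
        Real.norm_of_nonneg (by linarith)]
      linarith
    · conv_lhs => rw [hw (k + 1), hw k]
      simp only [ContinuousMap.add_apply, ContinuousMap.smul_apply, ← hym (k + 1)]
      module
    · have e1 := ((continuous_eval_const (rightEnd T)).tendsto _).comp
        ((tendsto_add_atTop_iff_nat 1).2 hwt)
      have e2 := ((continuous_eval_const (leftEnd T)).tendsto _).comp hwt
      simpa using e1.sub e2
  have hsub : ∀ (k : ℕ) {t : ℝ}, t ∈ Icc (-(k * T)) (-(k * T) + T) →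
      t - T ∈ Icc (-((k + 1 : ℕ) * T)) (-((k + 1 : ℕ) * T) + T) := fun k t ht => by
    push_cast
    exact ⟨by linarith [ht.1], by linarith [ht.2]⟩
  have hshift : ∀ (k : ℕ) (t : ℝ), t - T + (k + 1 : ℕ) * T = t + k * T := fun k t => by
    push_cast; ring
  refine ⟨glue y, glue w, continuousOn_glue hym, continuousOn_glue hwm, ?_, ?_, fun t => hRy _ _,
    fun t => hRw _ _, ?_, ?_⟩
  · intro k t ht
    refine hasDerivWithinAt_glue hym
      (f := fun t => M t (glue y t) + C t (glue w t) + g (glue y t)) (fun k t => ?_) k ht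
    have hm : (t : ℝ) - k * T ∈ Icc (-(k * T)) (-(k * T) + T) :=
      ⟨by linarith [t.2.1], by linarith [t.2.2]⟩
    have h := hasDerivWithinAt_of_eq_volterra (hy k) t
    rw [glue_eq hym k hm, glue_eq hwm k hm, sub_add_cancel, IccExtend_of_mem _ _ t.2,
      IccExtend_of_mem _ _ t.2, hMT.sub_nat_mul_eq, hCT.sub_nat_mul_eq]
    exact h
  · intro t ht
    obtain ⟨k, hk⟩ := exists_block T ht
    rw [glue_eq hwm k hk, glue_eq hwm _ (hsub k hk), glue_eq hym _ (hsub k hk), hshift, hw k]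
    rfl
  · intro δ hδ
    have e1 := (Metric.tendsto_atTop.1 hyt) δ hδ
    have e2 := (Metric.tendsto_atTop.1 hwt) δ hδ
    obtain ⟨n₁, e1⟩ := e1
    obtain ⟨n₂, e2⟩ := e2
    refine ⟨-((n₁ + n₂ : ℕ) * T), fun t ht => ?_⟩
    obtain ⟨k, hk⟩ := exists_block T (t := t) (ht.trans (by
      have : (0 : ℝ) ≤ (n₁ + n₂ : ℕ) * T := by positivity
      linarith))
    have hkn : n₁ + n₂ ≤ k := by
      have : ((n₁ + n₂ : ℕ) : ℝ) ≤ k := le_of_mul_le_mul_right (by linarith [hk.1]) h0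
      exact_mod_cast this
    rw [glue_eq hym k hk, glue_eq hwm k hk]
    have e1' := e1 k (by omega)
    have e2' := e2 k (by omega)
    rw [dist_zero_right] at e1' e2'
    exact ⟨((y k).norm_coe_le_norm _).trans_lt e1', ((w k).norm_coe_le_norm _).trans_lt e2'⟩
  · have hm : (s₀ : ℝ) - k₀ * T ∈ Icc (-(k₀ * T)) (-(k₀ * T) + T) :=
      ⟨by linarith [s₀.2.1], by linarith [s₀.2.2]⟩
    have : (0 : ℝ) ≤ k₀ * T := by positivity
    refine ⟨s₀ - k₀ * T, by linarith [s₀.2.2], ?_⟩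
    rw [glue_eq hym k₀ hm, glue_eq hym _ (hsub k₀ hm), hshift, sub_add_cancel,
      IccExtend_of_mem _ _ s₀.2, IccExtend_of_mem _ _ s₀.2]
    exact hne

end Gluing

/-! ### Roots of the characteristic equation with effective gain. -/

section Roots

open Filter Topology

/-- The feedback parameter at which a multiplier `l` of the delay system is a multiplier of the
ordinary differential equation. -/
noncomputable def effectiveGain (ε : ℝ) (l : ℂ) : ℂ := (l - 1) / (l - 1 + ε)

theorem sub_one_add_ne_zero {ε : ℝ} (h0 : 0 ≤ ε) (h1 : ε ≤ 1) {l : ℂ} (hl : 1 < ‖l‖) :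
    l - 1 + (ε : ℂ) ≠ 0 := by
  intro h
  have : l = ((1 - ε : ℝ) : ℂ) := by push_cast; linear_combination h
  rw [this, Complex.norm_real, Real.norm_of_nonneg (by linarith)] at hl
  linarith

/-- At `x = 0` the value is `(1 - p₁ 0)(ε + q₂ 0) < 0`. For large `x` the product grows
quadratically, while all four functions stay bounded because their argument stays in `[0, 1]`. The
intermediate value theorem applies. -/
theorem exists_pos_root_of_real {p₁ p₂ q₁ q₂ : ℝ → ℝ} (hp₁ : Continuous p₁) (hp₂ : Continuous p₂)
    (hq₁ : Continuous q₁) (hq₂ : Continuous q₂) (h₁ : 1 < p₁ 0) (h₂ : p₂ 0 = 0) (hq : 0 ≤ q₂ 0)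
    {ε : ℝ} (hε : 0 < ε) :
    ∃ x > 0, (1 + ε * x - p₁ (x / (1 + x))) * (ε * (1 + x) + q₂ (x / (1 + x))) +
      p₂ (x / (1 + x)) * q₁ (x / (1 + x)) = 0 := by
  let k : ℝ → ℝ := fun x => (1 + ε * x - p₁ (x / (1 + x))) * (ε * (1 + x) + q₂ (x / (1 + x))) +
      p₂ (x / (1 + x)) * q₁ (x / (1 + x))
  have hbd : ∀ f : ℝ → ℝ, Continuous f → ∃ m : ℝ, ∀ s ∈ Icc (0 : ℝ) 1, ‖f s‖ ≤ m := fun f hf =>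
    isCompact_Icc.exists_bound_of_continuousOn hf.continuousOn
  obtain ⟨m₁, hm₁⟩ := hbd p₁ hp₁
  obtain ⟨m₂, hm₂⟩ := hbd p₂ hp₂
  obtain ⟨m₃, hm₃⟩ := hbd q₁ hq₁
  obtain ⟨m₄, hm₄⟩ := hbd q₂ hq₂
  have h01 : (0 : ℝ) ∈ Icc (0 : ℝ) 1 := by simp
  have n₁ := (norm_nonneg _).trans (hm₁ 0 h01)
  have n₂ := (norm_nonneg _).trans (hm₂ 0 h01)
  have n₃ := (norm_nonneg _).trans (hm₃ 0 h01)
  have n₄ := (norm_nonneg _).trans (hm₄ 0 h01)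
  set m := m₁ + m₂ + m₃ + m₄ with hm
  have hk0 : k 0 < 0 := by
    simp only [k, zero_div, h₂, mul_zero, add_zero, zero_mul, mul_one]
    exact mul_neg_of_neg_of_pos (by linarith) (by linarith)
  -- With `ε b = 2m + 1` both factors are at least `m + 1`, so their product beats `|p₂ q₁| ≤ m ^
  -- 2`.
  set b := (2 * m + 1) / ε with hb
  have hb0 : 0 < b := by positivity
  have hεb : ε * b = 2 * m + 1 := by rw [hb]; field_simp
  have hkb : 0 < k b := by
    have hs : b / (1 + b) ∈ Icc (0 : ℝ) 1 :=
      ⟨by positivity, div_le_one_of_le₀ (by linarith) (by positivity)⟩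
    have e₁ := abs_le.1 (hm₁ _ hs)
    have e₂ := hm₂ _ hs
    have e₃ := hm₃ _ hs
    have e₄ := abs_le.1 (hm₄ _ hs)
    have e₅ : |p₂ (b / (1 + b)) * q₁ (b / (1 + b))| ≤ m * m := by
      rw [abs_mul]
      exact mul_le_mul (by simp only [Real.norm_eq_abs] at e₂; linarith)
        (by simp only [Real.norm_eq_abs] at e₃; linarith) (abs_nonneg _) (by positivity)
    have e₆ : (m + 1) * (m + 1) ≤
        (1 + ε * b - p₁ (b / (1 + b))) * (ε * (1 + b) + q₂ (b / (1 + b))) :=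
      mul_le_mul (by linarith) (by rw [mul_add]; linarith) (by positivity)
        (by linarith)
    have e₇ := (abs_le.1 e₅).1
    simp only [k]
    nlinarith
  have hcont : ContinuousOn k (Icc 0 b) := by
    have hdiv : ContinuousOn (fun x : ℝ => x / (1 + x)) (Icc 0 b) :=
      continuousOn_id.div (by fun_prop) fun x hx => by linarith [hx.1]
    exact (((continuousOn_const.add (by fun_prop)).sub (hp₁.comp_continuousOn hdiv)).mul
      ((by fun_prop : ContinuousOn (fun x : ℝ => ε * (1 + x)) (Icc 0 b)).add
        (hq₂.comp_continuousOn hdiv))).add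
      ((hp₂.comp_continuousOn hdiv).mul (hq₁.comp_continuousOn hdiv))
  obtain ⟨x, hx, hkx⟩ := intermediate_value_Icc hb0.le hcont ⟨hk0.le, hkb.le⟩
  refine ⟨x, lt_of_le_of_ne hx.1 ?_, hkx⟩
  rintro rfl
  exact hk0.ne hkx

/-- The value at `l` of the characteristic polynomial of a two-by-two matrix. -/
def charVal (A : Matrix (Fin 2) (Fin 2) ℂ) (l : ℂ) : ℂ :=
  (l - A 0 0) * (l - A 1 1) - A 0 1 * A 1 0

/-- The determinant is the product of the two eigenvalues, so they cannot both lie in the closed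
unit disc. -/
theorem exists_charVal_root {A : Matrix (Fin 2) (Fin 2) ℂ}
    (hA : 1 < ‖A 0 0 * A 1 1 - A 0 1 * A 1 0‖) :
    ∃ a b : ℂ, 1 < ‖a‖ ∧ ∀ l, charVal A l = (l - a) * (l - b) := by
  obtain ⟨a, ha⟩ := exists_quadratic_eq_zero (a := (1 : ℂ))
    (b := -(A 0 0 + A 1 1)) (c := A 0 0 * A 1 1 - A 0 1 * A 1 0) one_ne_zero
    (by
      obtain ⟨s, hs⟩ := IsAlgClosed.exists_pow_nat_eq
        (discrim (1 : ℂ) (-(A 0 0 + A 1 1)) (A 0 0 * A 1 1 - A 0 1 * A 1 0)) zero_lt_two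
      exact ⟨s, by rw [← hs, sq]⟩)
  set b := A 0 0 + A 1 1 - a with hb
  have hab : A 0 0 * A 1 1 - A 0 1 * A 1 0 = a * b := by rw [hb]; linear_combination ha
  have hfac : ∀ l, charVal A l = (l - a) * (l - b) := fun l => by
    rw [charVal, hb]; linear_combination ha
  rw [hab, norm_mul] at hA
  by_cases h : 1 < ‖a‖
  · exact ⟨a, b, h, hfac⟩
  · refine ⟨b, a, ?_, fun l => by rw [hfac, mul_comm]⟩
    by_contra h'
    push Not at h h'
    exact absurd hA (not_lt.2 (mul_le_one₀ h (norm_nonneg _) h'))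

/-- This is Hurwitz's argument by the maximum principle. If the perturbed function had no zero in a
disc about the root `a`, its inverse would be bounded at `a` by its values on the circle; but the
function is small at `a` and bounded below on the circle. -/
theorem exists_charVal_effectiveGain_root {A : ℂ → Matrix (Fin 2) (Fin 2) ℂ}
    (hA : ∀ i j, Differentiable ℂ fun s => A s i j)
    (h1 : 1 < ‖A 1 0 0 * A 1 1 1 - A 1 0 1 * A 1 1 0‖) :
    ∃ ε₀ > 0, ∀ ε : ℝ, 0 < ε → ε < ε₀ →
      ∃ l : ℂ, 1 < ‖l‖ ∧ charVal (A (effectiveGain ε l)) l = 0 := by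
  obtain ⟨a, b, ha, hab⟩ := exists_charVal_root h1
  -- The disc stays outside the closed unit disc and its circle misses the other root `b`, which may
  -- lie inside or coincide with `a`.
  obtain ⟨ρ, hρ0, hρa, hρb⟩ : ∃ ρ > 0, ρ < ‖a‖ - 1 ∧ ρ ≠ ‖b - a‖ := by
    have h0 : 0 < ‖a‖ - 1 := by linarith
    by_cases h : (‖a‖ - 1) / 2 = ‖b - a‖
    · exact ⟨(‖a‖ - 1) / 3, by positivity, by linarith, by rw [← h]; intro h'; linarith⟩
    · exact ⟨(‖a‖ - 1) / 2, by positivity, by linarith, h⟩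
  have hball : ∀ l ∈ Metric.closedBall a ρ, 1 < ‖l‖ := fun l hl => by
    have h2 := norm_sub_norm_le a l
    rw [mem_closedBall_iff_norm, ← norm_neg, neg_sub] at hl
    linarith
  let H : ℝ → ℂ → ℂ := fun ε l => charVal (A (effectiveGain ε l)) l
  have hH0 : ∀ l, 1 < ‖l‖ → H 0 l = (l - a) * (l - b) := fun l hl => by
    have h := sub_one_add_ne_zero le_rfl zero_le_one hl
    have hg : effectiveGain 0 l = 1 := by
      rw [effectiveGain]
      simp only [Complex.ofReal_zero, add_zero] at h ⊢
      exact div_self h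
    simp only [H]
    rw [hg, hab]
  have hHc : ∀ l, 1 < ‖l‖ → ContinuousAt (fun z : ℝ × ℂ => H z.1 z.2) (0, l) := fun l hl => by
    have hg : ContinuousAt (fun z : ℝ × ℂ => effectiveGain z.1 z.2) (0, l) := by
      unfold effectiveGain
      refine ContinuousAt.div (by fun_prop) (by fun_prop) ?_
      exact sub_one_add_ne_zero le_rfl zero_le_one hl
    have hAc : ∀ i j, ContinuousAt (fun z : ℝ × ℂ => A (effectiveGain z.1 z.2) i j) (0, l) :=
      fun i j => ((hA i j).continuous.continuousAt).comp hg
    exact ((continuousAt_snd.sub (hAc 0 0)).mul (continuousAt_snd.sub (hAc 1 1))).sub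
      ((hAc 0 1).mul (hAc 1 0))
  obtain ⟨m, hm0, hm⟩ : ∃ m > 0, ∀ l ∈ Metric.sphere a ρ, m < ‖H 0 l‖ := by
    refine ⟨ρ * |ρ - ‖b - a‖| / 2, ?_, fun l hl => ?_⟩
    · have := abs_pos.2 (sub_ne_zero.2 hρb); positivity
    · rw [hH0 l (hball l (Metric.sphere_subset_closedBall hl)), norm_mul,
        mem_sphere_iff_norm.1 hl]
      have h2 := abs_norm_sub_norm_le (l - a) (b - a)
      rw [mem_sphere_iff_norm.1 hl, sub_sub_sub_cancel_right] at h2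
      have h3 : 0 < |ρ - ‖b - a‖| := abs_pos.2 (sub_ne_zero.2 hρb)
      have h4 : ρ * |ρ - ‖b - a‖| ≤ ρ * ‖l - b‖ := mul_le_mul_of_nonneg_left h2 hρ0.le
      have h5 : 0 < ρ * |ρ - ‖b - a‖| := by positivity
      linarith
  have hev1 : ∀ᶠ ε : ℝ in 𝓝 0, ∀ l ∈ Metric.sphere a ρ, m < ‖H ε l‖ := by
    refine (isCompact_sphere a ρ).eventually_forall_of_forall_eventually fun l hl => ?_
    exact (hHc l (hball l (Metric.sphere_subset_closedBall hl))).norm.eventually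
      (lt_mem_nhds (hm l hl))
  have hev2 : ∀ᶠ ε : ℝ in 𝓝 0, ‖H ε a‖ < m := by
    have hc : ContinuousAt (fun ε : ℝ => H ε a) 0 :=
      ContinuousAt.comp (f := fun ε : ℝ => (ε, a)) (g := fun z : ℝ × ℂ => H z.1 z.2) (hHc a ha)
        (by fun_prop)
    refine hc.norm.eventually (gt_mem_nhds ?_)
    simp only
    rw [hH0 a ha]
    simpa using hm0
  obtain ⟨ε₁, hε₁, hball1⟩ := Metric.eventually_nhds_iff.1 (hev1.and hev2)
  refine ⟨min ε₁ 1, by positivity, fun ε hε hεlt => ?_⟩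
  obtain ⟨hs, hc⟩ := hball1 (y := ε) (by
    rw [Real.dist_eq, sub_zero, abs_of_pos hε]; exact hεlt.trans_le (min_le_left _ _))
  have hε1 : ε ≤ 1 := hεlt.le.trans (min_le_right _ _)
  by_contra! hne
  have hHd : DifferentiableOn ℂ (H ε) (Metric.closedBall a ρ) := fun l hl => by
    have hg : DifferentiableAt ℂ (effectiveGain ε) l := by
      unfold effectiveGain
      exact DifferentiableAt.div (by fun_prop) (by fun_prop)
        (sub_one_add_ne_zero hε.le hε1 (hball l hl))
    have hAd : ∀ i j, DifferentiableAt ℂ (fun l => A (effectiveGain ε l) i j) l :=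
      fun i j => ((hA i j) _).comp l hg
    exact (((differentiableAt_id.sub (hAd 0 0)).mul (differentiableAt_id.sub (hAd 1 1))).sub
      ((hAd 0 1).mul (hAd 1 0))).differentiableWithinAt
  have hHne : ∀ l ∈ Metric.closedBall a ρ, H ε l ≠ 0 := fun l hl => hne l (hball l hl)
  have hd : DiffContOnCl ℂ (fun l => (H ε l)⁻¹) (Metric.ball a ρ) := by
    refine DifferentiableOn.diffContOnCl ?_
    rw [closure_ball a hρ0.ne']
    exact hHd.inv hHne
  have hmax := Complex.norm_le_of_forall_mem_frontier_norm_le Metric.isBounded_ball hd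
    (C := m⁻¹) (fun l hl => by
      rw [frontier_ball a hρ0.ne'] at hl
      rw [norm_inv]
      exact inv_anti₀ hm0 (hs l hl).le) (subset_closure (Metric.mem_ball_self hρ0))
  rw [norm_inv, inv_le_inv₀ (norm_pos_iff.2 (hHne a (Metric.mem_closedBall_self hρ0.le))) hm0]
    at hmax
  exact absurd hc (not_lt.2 hmax)

end Roots

/-! ### Holomorphic dependence on the gain, and scalar linear equations. -/

section Parameter

theorem differentiable_inverse_add_smul {A : Type*} [NormedRing A] [NormedAlgebra ℂ A]
    [CompleteSpace A] {a b : A} (hu : ∀ s : ℂ, IsUnit (a + s • b)) :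
    Differentiable ℂ fun s : ℂ => Ring.inverse (a + s • b) := fun s => by
  have hd : DifferentiableAt ℂ (fun s : ℂ => a + s • b) s := by fun_prop
  exact (differentiableAt_inverse (hu s)).comp s hd

variable {T : ℝ} [hT : Fact (0 < T)] {F : Type*} [NormedAddCommGroup F] [NormedSpace ℂ F]

theorem add_neg_zero_smul (M C : C(Icc (0 : ℝ) T, F →L[ℂ] F)) : M + (-0 : ℂ) • C = M := by
  ext t a
  change M t a + (-0 : ℂ) • C t a = M t a
  simp

variable [CompleteSpace F]

theorem differentiable_solOp (M C : C(Icc (0 : ℝ) T, F →L[ℂ] F)) (f : C(Icc (0 : ℝ) T, F)) :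
    Differentiable ℂ fun s : ℂ => solOp (M + (-s) • C) f := by
  have he : ∀ s : ℂ, 1 - volterra T F * mulOp (M + (-s) • C) =
      (1 - volterra T F * mulOp M) + s • (volterra T F * mulOp C) := fun s => by
    rw [mulOp_add_smul]
    ext f t
    simp
    module
  have h := differentiable_inverse_add_smul (a := 1 - volterra T F * mulOp M)
    (b := volterra T F * mulOp C) fun s => by
      rw [← he]; exact isUnit_one_sub_volterra_mulOp _
  have h2 := h.clm_apply (differentiable_const f)
  simp only [← he] at h2
  exact h2

theorem hasDerivWithinAt_solOp (N : C(Icc (0 : ℝ) T, F →L[ℂ] F)) (v : F) (t : Icc (0 : ℝ) T) :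
    HasDerivWithinAt (IccExtend hT.out.le (solOp N (constCLM T F v)))
      (N t (solOp N (constCLM T F v) t)) (Icc 0 T) t :=
  hasDerivWithinAt_of_eq_volterra (solOp_eq N _) t

theorem eq_exp_of_hasDerivWithinAt {u : ℝ → ℂ} {a : ℝ}
    (hu : ∀ t ∈ Icc 0 T, HasDerivWithinAt u (a * u t) (Icc 0 T) t) :
    u T = Real.exp (a * T) * u 0 := by
  have h0 := hT.out
  have hd : ∀ t ∈ Icc 0 T,
      HasDerivWithinAt (fun t => (Real.exp (-(a * t)) : ℂ) * u t) 0 (Icc 0 T) t := fun t ht => by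
    have h1 : HasDerivAt (fun t : ℝ => Real.exp (-(a * t))) (Real.exp (-(a * t)) * -(a * 1)) t :=
      (((hasDerivAt_id t).const_mul a).neg).exp
    have h2 := (h1.ofReal_comp.hasDerivWithinAt (s := Icc 0 T)).mul (hu t ht)
    refine h2.congr_deriv ?_
    push_cast
    ring
  have h := constant_of_derivWithin_zero (fun t ht => (hd t ht).differentiableWithinAt)
    (fun t ht => (hd t ⟨ht.1, ht.2.le⟩).derivWithin
      (uniqueDiffOn_Icc h0 t ⟨ht.1, ht.2.le⟩)) T ⟨h0.le, le_rfl⟩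
  simp only [mul_zero, neg_zero, Real.exp_zero, Complex.ofReal_one, one_mul] at h
  rw [← h, ← mul_assoc, ← Complex.ofReal_mul, ← Real.exp_add]
  simp

end Parameter

/-! ### The monodromy matrix in the rotating frame and the unstable multiplier. -/

section RotatingFrame

open MeasureTheory

instance fact_two_pi_pos : Fact (0 < 2 * Real.pi) := ⟨Real.two_pi_pos⟩

/-- The action of a real matrix on complex vectors. -/
noncomputable def matCLM (A : Matrix (Fin 2) (Fin 2) ℝ) : (Fin 2 → ℂ) →L[ℂ] (Fin 2 → ℂ) :=
  LinearMap.toContinuousLinearMap (Matrix.toLin' (A.map Complex.ofReal))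

theorem matCLM_apply (A : Matrix (Fin 2) (Fin 2) ℝ) (v : Fin 2 → ℂ) (i : Fin 2) :
    matCLM A v i = A i 0 * v 0 + A i 1 * v 1 := by
  simp [matCLM, Matrix.mulVec, dotProduct, Fin.sum_univ_two]

theorem continuous_matCLM : Continuous matCLM := by
  have h : Continuous ((LinearMap.toContinuousLinearMap :
      ((Fin 2 → ℂ) →ₗ[ℂ] (Fin 2 → ℂ)) ≃ₗ[ℂ] ((Fin 2 → ℂ) →L[ℂ] (Fin 2 → ℂ))).toLinearMap ∘ₗ
      (Matrix.toLin' : Matrix (Fin 2) (Fin 2) ℂ ≃ₗ[ℂ] _).toLinearMap) :=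
    LinearMap.continuous_of_finiteDimensional _
  exact h.comp (continuous_id.matrix_map Complex.continuous_ofReal)

/-- The real part as a real-linear map. -/
noncomputable def rePart : (Fin 2 → ℂ) →L[ℝ] (Fin 2 → ℂ) :=
  ContinuousLinearMap.pi fun i =>
    Complex.ofRealCLM ∘L Complex.reCLM ∘L ContinuousLinearMap.proj i

@[simp] theorem rePart_apply (v : Fin 2 → ℂ) (i : Fin 2) : rePart v i = ((v i).re : ℂ) := rfl

theorem rePart_matCLM (A : Matrix (Fin 2) (Fin 2) ℝ) (v : Fin 2 → ℂ) :
    rePart (matCLM A v) = matCLM A (rePart v) := by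
  ext i
  simp [matCLM_apply]

/-- The uncontrolled linearisation in the rotating frame. -/
def driftMat (r : ℝ) : Matrix (Fin 2) (Fin 2) ℝ := !![2 * r ^ 2, 0; 0, 0]

/-- The feedback term `b Kᵀ` in the rotating frame. -/
noncomputable def feedbackMat (K₁ K₂ t : ℝ) : Matrix (Fin 2) (Fin 2) ℝ :=
  !![(Real.sin t - Real.cos t) * (K₁ * Real.sin t - K₂ * Real.cos t),
     (Real.sin t - Real.cos t) * (K₁ * Real.cos t + K₂ * Real.sin t);
     (Real.cos t + Real.sin t) * (K₁ * Real.sin t - K₂ * Real.cos t),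
     (Real.cos t + Real.sin t) * (K₁ * Real.cos t + K₂ * Real.sin t)]

theorem continuous_feedbackMat (K₁ K₂ : ℝ) : Continuous (feedbackMat K₁ K₂) := by
  refine continuous_matrix fun i j => ?_
  fin_cases i <;> fin_cases j <;> simp [feedbackMat] <;> fun_prop

/-- The matrix is a rotated rank-one product of `b` and `K`; its trace is the rotation-invariant
scalar product of the two. -/
theorem feedbackMat_trace (K₁ K₂ t : ℝ) :
    feedbackMat K₁ K₂ t 0 0 + feedbackMat K₁ K₂ t 1 1 = K₁ + K₂ := by
  simp only [feedbackMat, Matrix.of_apply, Matrix.cons_val_zero, Matrix.cons_val_one,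
    Matrix.cons_val', Matrix.cons_val_fin_one]
  linear_combination (K₁ + K₂) * Real.sin_sq_add_cos_sq t

/-- The drift as a family of operators. -/
noncomputable def driftOp (r : ℝ) :
    C(Icc (0 : ℝ) (2 * Real.pi), (Fin 2 → ℂ) →L[ℂ] (Fin 2 → ℂ)) :=
  ⟨fun _ => matCLM (driftMat r), continuous_const⟩

/-- The feedback as a family of operators. -/
noncomputable def feedbackOp (K₁ K₂ : ℝ) :
    C(Icc (0 : ℝ) (2 * Real.pi), (Fin 2 → ℂ) →L[ℂ] (Fin 2 → ℂ)) :=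
  ⟨fun t => matCLM (feedbackMat K₁ K₂ t),
    continuous_matCLM.comp ((continuous_feedbackMat K₁ K₂).comp continuous_subtype_val)⟩

variable (r K₁ K₂ : ℝ)

/-- The fundamental solution of the linearisation with feedback gain reduced by `s`. -/
noncomputable def fundSol (s : ℂ) (j : Fin 2) : C(Icc (0 : ℝ) (2 * Real.pi), Fin 2 → ℂ) :=
  solOp (driftOp r + (-s) • feedbackOp K₁ K₂) (constCLM _ _ (Pi.single j 1))

/-- The monodromy matrix of the linearisation with feedback gain reduced by `s`. -/
noncomputable def monoMat (s : ℂ) : Matrix (Fin 2) (Fin 2) ℂ :=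
  Matrix.of fun i j => fundSol r K₁ K₂ s j (rightEnd _) i

/-- The contribution of the feedback to the second row of the monodromy matrix. -/
noncomputable def feedbackDrift (s : ℂ) (j : Fin 2) : ℂ :=
  volterra _ _ (mulOp (feedbackOp K₁ K₂) (fundSol r K₁ K₂ s j)) (rightEnd _) 1

theorem differentiable_fundSol (j : Fin 2) : Differentiable ℂ fun s => fundSol r K₁ K₂ s j :=
  differentiable_solOp _ _ _

theorem differentiable_monoMat (i j : Fin 2) :
    Differentiable ℂ fun s => monoMat r K₁ K₂ s i j :=
  ((ContinuousLinearMap.proj i : (Fin 2 → ℂ) →L[ℂ] ℂ) ∘L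
    ContinuousMap.evalCLM ℂ (rightEnd _)).differentiable.comp (differentiable_fundSol r K₁ K₂ j)

theorem continuous_feedbackDrift (j : Fin 2) : Continuous fun s => feedbackDrift r K₁ K₂ s j :=
  ((ContinuousLinearMap.proj 1 : (Fin 2 → ℂ) →L[ℂ] ℂ) ∘L
    ContinuousMap.evalCLM ℂ (rightEnd _) ∘L volterra _ _ ∘L
      mulOp (feedbackOp K₁ K₂)).continuous.comp (differentiable_fundSol r K₁ K₂ j).continuous

theorem volterra_apply_coord (f : C(Icc (0 : ℝ) (2 * Real.pi), Fin 2 → ℂ))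
    (t : Icc (0 : ℝ) (2 * Real.pi)) (i : Fin 2) :
    volterra _ _ f t i = ∫ τ in (0 : ℝ)..t, IccExtend Real.two_pi_pos.le f τ i := by
  have := (ContinuousLinearMap.proj i : (Fin 2 → ℂ) →L[ℂ] ℂ).intervalIntegral_comp_comm
    ((continuous_extend f).intervalIntegrable (μ := volume) 0 (t : ℝ))
  exact this.symm

theorem volterra_driftOp_apply_one (f : C(Icc (0 : ℝ) (2 * Real.pi), Fin 2 → ℂ))
    (t : Icc (0 : ℝ) (2 * Real.pi)) : volterra _ _ (mulOp (driftOp r) f) t 1 = 0 := by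
  rw [volterra_apply_coord]
  have : ∀ τ, IccExtend Real.two_pi_pos.le (mulOp (driftOp r) f) τ 1 = 0 := fun τ => by
    change matCLM (driftMat r) _ 1 = 0
    rw [matCLM_apply]
    simp [driftMat]
  simp [this]

/-- The drift has a zero tangential row, so the second row leaves the identity only through the
feedback. This exposes the factor `s` that is cancelled in the characteristic equation. -/
theorem monoMat_one_apply (s : ℂ) (j : Fin 2) :
    monoMat r K₁ K₂ s 1 j = (Pi.single j 1 : Fin 2 → ℂ) 1 - s * feedbackDrift r K₁ K₂ s j := by
  have h := (solOp_eq_iff _ _ _).1 (show _ = fundSol r K₁ K₂ s j from rfl)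
  rw [mulOp_add_smul, add_apply, map_add] at h
  have h2 := congrFun (DFunLike.congr_fun h (rightEnd _)) 1
  change _ = (Pi.single j 1 : Fin 2 → ℂ) 1 +
    (volterra _ _ (mulOp (driftOp r) (fundSol r K₁ K₂ s j)) (rightEnd _) 1 +
      volterra _ _ ((-s) • mulOp (feedbackOp K₁ K₂) (fundSol r K₁ K₂ s j)) (rightEnd _) 1) at h2
  rw [volterra_driftOp_apply_one, map_smul, ContinuousMap.smul_apply, Pi.smul_apply, zero_add,
    smul_eq_mul, neg_mul, ← sub_eq_add_neg] at h2
  exact h2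

theorem fundSol_zero (j : Fin 2) :
    fundSol r K₁ K₂ 0 j = solOp (driftOp r) (constCLM _ _ (Pi.single j 1)) := by
  rw [fundSol, add_neg_zero_smul]

theorem fundSol_zero_one : fundSol r K₁ K₂ 0 1 = constCLM _ _ (Pi.single 1 1) := by
  rw [fundSol_zero, solOp_eq_iff]
  have : mulOp (driftOp r) (constCLM (2 * Real.pi) (Fin 2 → ℂ) (Pi.single 1 1)) = 0 := by
    ext t i
    change matCLM (driftMat r) _ i = 0
    rw [matCLM_apply]
    fin_cases i <;> simp [driftMat]
  rw [this, map_zero, add_zero]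

theorem monoMat_zero_zero_one : monoMat r K₁ K₂ 0 0 1 = 0 := by
  rw [monoMat, Matrix.of_apply, fundSol_zero_one]
  simp

theorem monoMat_zero_zero_zero :
    monoMat r K₁ K₂ 0 0 0 = Real.exp (2 * r ^ 2 * (2 * Real.pi)) := by
  have h := eq_exp_of_hasDerivWithinAt (T := 2 * Real.pi) (a := 2 * r ^ 2)
    (u := fun t => IccExtend Real.two_pi_pos.le (fundSol r K₁ K₂ 0 0) t 0) (fun t ht => by
      rw [fundSol_zero]
      have h1 := hasDerivWithinAt_pi.1 (hasDerivWithinAt_solOp (driftOp r)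
        (Pi.single 0 1) ⟨t, ht⟩) 0
      refine h1.congr_deriv ?_
      change matCLM (driftMat r) _ 0 = _
      rw [matCLM_apply, IccExtend_of_mem _ _ ht]
      simp [driftMat])
  have h2 : fundSol r K₁ K₂ 0 0 (leftEnd _) = Pi.single 0 1 := solOp_leftEnd _ _
  have h3 : IccExtend Real.two_pi_pos.le (fundSol r K₁ K₂ 0 0) 0 = Pi.single 0 1 := by
    rw [← h2, IccExtend_left]; rfl
  rw [h3, IccExtend_right, Pi.single_eq_same, mul_one] at h
  exact h

/-- Without feedback the tangential vector is constant, so this is a plain integral of the lower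
right feedback entry over one period. -/
theorem feedbackDrift_zero_one : feedbackDrift r K₁ K₂ 0 1 = (Real.pi * (K₁ + K₂) : ℝ) := by
  rw [feedbackDrift, fundSol_zero_one, volterra_apply_coord]
  have h : ∫ τ in (0 : ℝ)..(rightEnd (2 * Real.pi) : ℝ), IccExtend Real.two_pi_pos.le
      (mulOp (feedbackOp K₁ K₂) (constCLM _ _ (Pi.single 1 1))) τ 1 =
      ∫ τ in (0 : ℝ)..2 * Real.pi, ((K₁ * Real.cos τ ^ 2 + (K₁ + K₂) * (Real.sin τ * Real.cos τ) +
        K₂ * Real.sin τ ^ 2 : ℝ) : ℂ) := by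
    refine intervalIntegral.integral_congr fun τ hτ => ?_
    change τ ∈ uIcc 0 (2 * Real.pi) at hτ
    rw [uIcc_of_le Real.two_pi_pos.le] at hτ
    rw [IccExtend_of_mem _ _ hτ]
    change matCLM (feedbackMat K₁ K₂ τ) _ 1 = _
    rw [matCLM_apply, constCLM_apply]
    simp [feedbackMat]
    ring
  rw [h, intervalIntegral.integral_ofReal]
  congr 1
  rw [intervalIntegral.integral_add, intervalIntegral.integral_add,
    intervalIntegral.integral_const_mul, intervalIntegral.integral_const_mul,
    intervalIntegral.integral_const_mul, integral_cos_sq, integral_sin_sq, integral_sin_mul_cos₁]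
  · simp
    ring
  all_goals exact Continuous.intervalIntegrable (by fun_prop) _ _

/-- Liouville's formula: the Wronskian satisfies a scalar equation whose coefficient, the trace `2r²
- (K₁ + K₂)`, is constant in time. -/
theorem monoMat_one_det :
    monoMat r K₁ K₂ 1 0 0 * monoMat r K₁ K₂ 1 1 1 - monoMat r K₁ K₂ 1 0 1 * monoMat r K₁ K₂ 1 1 0 =
      Real.exp ((2 * r ^ 2 - (K₁ + K₂)) * (2 * Real.pi)) := by
  let y : Fin 2 → ℝ → Fin 2 → ℂ := fun j => IccExtend Real.two_pi_pos.le (fundSol r K₁ K₂ 1 j)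
  have hy : ∀ (j i : Fin 2), ∀ t ∈ Icc (0 : ℝ) (2 * Real.pi),
      HasDerivWithinAt (fun t => y j t i)
        (((driftMat r i 0 - feedbackMat K₁ K₂ t i 0 : ℝ) : ℂ) * y j t 0 +
          ((driftMat r i 1 - feedbackMat K₁ K₂ t i 1 : ℝ) : ℂ) * y j t 1)
        (Icc 0 (2 * Real.pi)) t := fun j i t ht => by
    have h1 := hasDerivWithinAt_pi.1 (hasDerivWithinAt_solOp (driftOp r + (-1 : ℂ) •
        feedbackOp K₁ K₂) (Pi.single j 1) ⟨t, ht⟩) i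
    refine h1.congr_deriv ?_
    simp only [y]
    rw [IccExtend_of_mem _ _ ht, ContinuousMap.add_apply, ContinuousMap.smul_apply, add_apply,
      smul_apply, Pi.add_apply, Pi.smul_apply]
    change matCLM (driftMat r) _ i + _ • matCLM (feedbackMat K₁ K₂ t) _ i = _
    rw [matCLM_apply, matCLM_apply]
    simp only [fundSol, smul_eq_mul]
    push_cast
    ring
  have h := eq_exp_of_hasDerivWithinAt (T := 2 * Real.pi) (a := 2 * r ^ 2 - (K₁ + K₂))
    (u := fun t => y 0 t 0 * y 1 t 1 - y 1 t 0 * y 0 t 1) (fun t ht => by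
      have h1 := ((hy 0 0 t ht).mul (hy 1 1 t ht)).sub ((hy 1 0 t ht).mul (hy 0 1 t ht))
      refine h1.congr_deriv ?_
      have htr : ((feedbackMat K₁ K₂ t 0 0 : ℝ) : ℂ) + (feedbackMat K₁ K₂ t 1 1 : ℝ) =
          K₁ + K₂ := by exact_mod_cast feedbackMat_trace K₁ K₂ t
      have e1 : driftMat r 0 0 = 2 * r ^ 2 := rfl
      have e2 : driftMat r 0 1 = 0 := rfl
      have e3 : driftMat r 1 0 = 0 := rfl
      have e4 : driftMat r 1 1 = 0 := rfl
      rw [e1, e2, e3, e4]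
      push_cast
      linear_combination (-(y 0 t 0 * y 1 t 1 - y 1 t 0 * y 0 t 1)) * htr)
  have hT : ∀ j i, y j (2 * Real.pi) i = monoMat r K₁ K₂ 1 i j := fun j i => by
    simp only [y]; rw [IccExtend_right]; rfl
  have h0 : ∀ j, y j 0 = Pi.single j 1 := fun j => by
    simp only [y]; rw [IccExtend_left]; exact solOp_leftEnd _ _
  simp only [hT, h0] at h
  rw [h]
  simp

theorem realOp_fundSol (s : ℝ) (j : Fin 2) :
    realOp rePart (fundSol r K₁ K₂ s j) = fundSol r K₁ K₂ s j := by
  rw [fundSol, realOp_solOp, realOp_constCLM]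
  · congr 2
    ext i
    by_cases h : i = j
    · subst h; simp
    · simp [h]
  · intro t a
    ext i
    rw [ContinuousMap.add_apply, ContinuousMap.smul_apply, add_apply, add_apply, smul_apply,
      smul_apply, map_add]
    change (rePart (matCLM (driftMat r) a) + rePart ((-s : ℂ) • matCLM (feedbackMat K₁ K₂ t) a)) i =
      (matCLM (driftMat r) (rePart a) + (-s : ℂ) • matCLM (feedbackMat K₁ K₂ t) (rePart a)) i
    rw [rePart_matCLM, ← rePart_matCLM (feedbackMat K₁ K₂ t)]
    simp

theorem ofReal_re_monoMat (s : ℝ) (i j : Fin 2) :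
    ((monoMat r K₁ K₂ s i j).re : ℂ) = monoMat r K₁ K₂ s i j :=
  congrFun (DFunLike.congr_fun (realOp_fundSol r K₁ K₂ s j) (rightEnd _)) i

theorem ofReal_re_feedbackDrift (s : ℝ) (j : Fin 2) :
    ((feedbackDrift r K₁ K₂ s j).re : ℂ) = feedbackDrift r K₁ K₂ s j := by
  have h : realOp rePart (volterra _ _ (mulOp (feedbackOp K₁ K₂) (fundSol r K₁ K₂ s j))) =
      volterra _ _ (mulOp (feedbackOp K₁ K₂) (fundSol r K₁ K₂ s j)) := by
    rw [realOp_volterra, realOp_mulOp (fun t => rePart_matCLM _), realOp_fundSol]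
  exact congrFun (DFunLike.congr_fun h (rightEnd _)) 1

theorem monodromy_apply_eq_mulVec (s : ℂ) (v : Fin 2 → ℂ) :
    monodromy (driftOp r + (-s) • feedbackOp K₁ K₂) v = (monoMat r K₁ K₂ s).mulVec v := by
  have hv : v = v 0 • Pi.single 0 1 + v 1 • Pi.single 1 1 := by
    ext i; fin_cases i <;> simp
  conv_lhs => rw [hv]
  rw [map_add, map_smul, map_smul]
  ext i
  simp [Matrix.mulVec, dotProduct, Fin.sum_univ_two, monoMat, fundSol, monodromy_apply, mul_comm]

theorem exists_monodromy_eigenvector {s l : ℂ} (h : charVal (monoMat r K₁ K₂ s) l = 0) :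
    ∃ v : Fin 2 → ℂ, v ≠ 0 ∧ monodromy (driftOp r + (-s) • feedbackOp K₁ K₂) v = l • v := by
  have hdet : (l • (1 : Matrix (Fin 2) (Fin 2) ℂ) - monoMat r K₁ K₂ s).det = 0 := by
    rw [Matrix.det_fin_two, ← h, charVal]
    simp
  obtain ⟨v, hv, hv0⟩ := Matrix.exists_mulVec_eq_zero_iff.2 hdet
  refine ⟨v, hv, ?_⟩
  rw [monodromy_apply_eq_mulVec]
  rw [Matrix.sub_mulVec, Matrix.smul_mulVec, Matrix.one_mulVec] at hv0
  exact (sub_eq_zero.1 hv0).symm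

/-- For all gains the linearised delay system has an unstable multiplier if `ε` is small. -/
theorem exists_unstable_multiplier (hr : r ≠ 0) :
    ∃ ε₀ > 0, ε₀ ≤ 1 ∧ ∀ ε : ℝ, 0 < ε → ε < ε₀ →
      ∃ l : ℂ, 1 < ‖l‖ ∧ ∃ v : Fin 2 → ℂ, v ≠ 0 ∧
        monodromy (driftOp r + (-effectiveGain ε l) • feedbackOp K₁ K₂) v = l • v := by
  have hr2 : 0 < r ^ 2 := by positivity
  rcases lt_or_ge (K₁ + K₂) 0 with hK | hK
  · obtain ⟨ε₀, hε₀, h⟩ := exists_charVal_effectiveGain_root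
      (A := monoMat r K₁ K₂) (differentiable_monoMat r K₁ K₂) (by
        rw [monoMat_one_det, Complex.norm_real, Real.norm_of_nonneg (Real.exp_pos _).le,
          Real.one_lt_exp_iff]
        exact mul_pos (by linarith) Real.two_pi_pos)
    refine ⟨min ε₀ 1, by positivity, min_le_right _ _, fun ε h0 h1 => ?_⟩
    obtain ⟨l, hl, hc⟩ := h ε h0 (h1.trans_le (min_le_left _ _))
    exact ⟨l, hl, exists_monodromy_eigenvector r K₁ K₂ hc⟩
  · refine ⟨1, one_pos, le_rfl, fun ε h0 _ => ?_⟩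
    have hm : ∀ i j, Continuous fun s : ℝ => (monoMat r K₁ K₂ s i j).re := fun i j =>
      Complex.continuous_re.comp
        ((differentiable_monoMat r K₁ K₂ i j).continuous.comp Complex.continuous_ofReal)
    have hq : ∀ j, Continuous fun s : ℝ => (feedbackDrift r K₁ K₂ s j).re := fun j =>
      Complex.continuous_re.comp
        ((continuous_feedbackDrift r K₁ K₂ j).comp Complex.continuous_ofReal)
    obtain ⟨x, hx, hroot⟩ := exists_pos_root_of_real (hm 0 0) (hm 0 1) (hq 0) (hq 1)
      (by
        rw [Complex.ofReal_zero, monoMat_zero_zero_zero, Complex.ofReal_re, Real.one_lt_exp_iff]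
        have := Real.two_pi_pos
        positivity)
      (by rw [Complex.ofReal_zero, monoMat_zero_zero_one, Complex.zero_re])
      (by
        rw [Complex.ofReal_zero, feedbackDrift_zero_one, Complex.ofReal_re]
        exact mul_nonneg Real.pi_pos.le hK) h0
    set s : ℝ := x / (1 + x) with hs
    -- The scaling `l = 1 + εx` makes the effective gain independent of `ε`.
    have hg : effectiveGain ε (1 + ε * x : ℝ) = (s : ℂ) := by
      have h1 : 1 + ε * x - 1 + ε ≠ 0 := by nlinarith [mul_pos h0 hx]
      rw [effectiveGain, hs]
      norm_cast
      field_simp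
      ring
    refine ⟨(1 + ε * x : ℝ), ?_, ?_⟩
    · have : 0 < ε * x := by positivity
      rw [Complex.norm_real, Real.norm_of_nonneg (by linarith)]
      linarith
    · rw [hg]
      refine exists_monodromy_eigenvector r K₁ K₂ ?_
      have hroot' := congrArg Complex.ofReal hroot
      push_cast at hroot'
      rw [ofReal_re_monoMat, ofReal_re_monoMat, ofReal_re_feedbackDrift, ofReal_re_feedbackDrift]
        at hroot'
      have hsx : (ε : ℂ) * x = s * (ε * (1 + x)) := by
        rw [hs]; norm_cast; field_simp
      rw [charVal, monoMat_one_apply, monoMat_one_apply]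
      simp only [Pi.single_eq_same, Pi.single_eq_of_ne (one_ne_zero : (1 : Fin 2) ≠ 0)]
      push_cast
      -- Since `εx = s ε (1 + x)`, the characteristic value is `s` times the function whose zero is
      -- `x`.
      linear_combination (s : ℂ) * hroot' + (1 + ε * x - monoMat r K₁ K₂ s 0 0) * hsx

end RotatingFrame

/-! ### Floquet multipliers of the Hopf normal form. -/

section Hopf

open Filter Topology

theorem hasDerivWithinAt_vec {a b : ℝ → ℝ} {a' b' t : ℝ} {s : Set ℝ}
    (ha : HasDerivWithinAt a a' s t) (hb : HasDerivWithinAt b b' s t) :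
    HasDerivWithinAt (fun t => (!₂[a t, b t] : State 2)) !₂[a', b'] s t := by
  have h := (ha.smul_const (!₂[1, 0] : State 2)).add (hb.smul_const (!₂[0, 1] : State 2))
  have he : ∀ x y : ℝ, x • (!₂[1, 0] : State 2) + y • (!₂[0, 1] : State 2) = !₂[x, y] :=
    fun x y => by ext i; fin_cases i <;> simp
  rw [he] at h
  exact h.congr (fun t _ => (he _ _).symm) (he _ _).symm

theorem continuousOn_vec {a b : ℝ → ℝ} {s : Set ℝ} (ha : ContinuousOn a s)
    (hb : ContinuousOn b s) : ContinuousOn (fun t => (!₂[a t, b t] : State 2)) s := by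
  have h := (ha.smul (continuousOn_const (c := (!₂[1, 0] : State 2)))).add
    (hb.smul (continuousOn_const (c := (!₂[0, 1] : State 2))))
  refine h.congr fun t _ => ?_
  ext i; fin_cases i <;> simp

theorem fderiv_hopfField (p : ℝ) (x v : State 2) :
    fderiv ℝ (fun x : State 2 => hopfField p x 0) x v =
      !₂[(p + 3 * x 0 ^ 2 + x 1 ^ 2) * v 0 + (-1 + 2 * x 0 * x 1) * v 1,
        (1 + 2 * x 0 * x 1) * v 0 + (p + x 0 ^ 2 + 3 * x 1 ^ 2) * v 1] := by
  have h0 : HasFDerivAt (fun x : State 2 => x 0) (EuclideanSpace.proj (𝕜 := ℝ) 0) x :=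
    (EuclideanSpace.proj (𝕜 := ℝ) (0 : Fin 2)).hasFDerivAt
  have h1 : HasFDerivAt (fun x : State 2 => x 1) (EuclideanSpace.proj (𝕜 := ℝ) 1) x :=
    (EuclideanSpace.proj (𝕜 := ℝ) (1 : Fin 2)).hasFDerivAt
  have hq := (h0.mul h0).add (h1.mul h1)
  have hf0 := ((h0.const_mul p).sub h1).add (h0.mul hq)
  have hf1 := (h0.add (h1.const_mul p)).add (h1.mul hq)
  have e0 : (fun x : State 2 => hopfField p x 0 0) = fun x =>
      p * x 0 - x 1 + x 0 * (x 0 * x 0 + x 1 * x 1) := by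
    funext x; simp [hopfField, sq]
  have e1 : (fun x : State 2 => hopfField p x 0 1) = fun x =>
      x 0 + p * x 1 + x 1 * (x 0 * x 0 + x 1 * x 1) := by
    funext x; simp [hopfField, sq]
  have hd : DifferentiableAt ℝ (fun x : State 2 => hopfField p x 0) x := by
    rw [differentiableAt_euclidean]
    intro i
    fin_cases i
    · change DifferentiableAt ℝ (fun x : State 2 => hopfField p x 0 0) x
      rw [e0]; exact hf0.differentiableAt
    · change DifferentiableAt ℝ (fun x : State 2 => hopfField p x 0 1) x
      rw [e1]; exact hf1.differentiableAt
  have c0 : HasFDerivAt (fun x : State 2 => hopfField p x 0 0) _ x :=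
    (EuclideanSpace.proj (𝕜 := ℝ) (0 : Fin 2)).hasFDerivAt.comp x hd.hasFDerivAt
  have c1 : HasFDerivAt (fun x : State 2 => hopfField p x 0 1) _ x :=
    (EuclideanSpace.proj (𝕜 := ℝ) (1 : Fin 2)).hasFDerivAt.comp x hd.hasFDerivAt
  rw [e0] at c0
  rw [e1] at c1
  ext i
  fin_cases i
  · have := DFunLike.congr_fun (c0.unique hf0) v
    simp at this ⊢
    rw [this]; ring
  · have := DFunLike.congr_fun (c1.unique hf1) v
    simp at this ⊢
    rw [this]; ring

theorem inputVector_hopfField (p : ℝ) (xs : ℝ → State 2) (t : ℝ) :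
    inputVector (hopfField p) xs t = !₂[1, 1] := by
  have he : (fun u : ℝ => hopfField p (xs t) u) =
      fun u => hopfField p (xs t) 0 + u • (!₂[1, 1] : State 2) := by
    funext u; ext i; fin_cases i <;> simp [hopfField]
  have h := ((hasDerivAt_id (0 : ℝ)).smul_const (!₂[1, 1] : State 2)).const_add
    (hopfField p (xs t) 0)
  rw [inputVector, he]
  simpa using h.deriv

theorem jacobian_hopfField {p : ℝ} (hp : p < 0) (t : ℝ) :
    jacobian (hopfField p) (hopfOrbit p) t =
      !![2 * Real.sqrt (-p) ^ 2 * Real.sin t ^ 2,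
          -1 - 2 * Real.sqrt (-p) ^ 2 * (Real.sin t * Real.cos t);
        1 - 2 * Real.sqrt (-p) ^ 2 * (Real.sin t * Real.cos t),
          2 * Real.sqrt (-p) ^ 2 * Real.cos t ^ 2] := by
  have hr : Real.sqrt (-p) ^ 2 = -p := Real.sq_sqrt (by linarith)
  have hsc := Real.sin_sq_add_cos_sq t
  ext i j
  rw [jacobian, Matrix.of_apply, fderiv_hopfField]
  fin_cases i <;> fin_cases j <;> simp [hopfOrbit, mul_pow, hr]
  · linear_combination (-p) * hsc
  · linear_combination (-2 * Real.sin t * Real.cos t) * hr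
  · linear_combination (-2 * Real.sin t * Real.cos t) * hr
  · linear_combination (-p) * hsc

theorem hopfOrbit_periodic (p : ℝ) : Function.Periodic (hopfOrbit p) (2 * Real.pi) := fun t => by
  simp [hopfOrbit]

theorem feedbackMat_periodic (K₁ K₂ : ℝ) :
    Function.Periodic (feedbackMat K₁ K₂) (2 * Real.pi) := fun t => by
  simp [feedbackMat]

/-- The eigenfunction of the reduced equation is continued to `[-T, 0]` by the factor `l⁻¹` and
rotated back; its multiple by `b` serves as the reference component. -/
theorem isFloquetMultiplier_of_monodromy {p : ℝ} (hp : p < 0) {K₁ K₂ ε : ℝ} {l : ℂ}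
    (hl0 : l ≠ 0) (hl : l - 1 + (ε : ℂ) ≠ 0) {v : Fin 2 → ℂ} (hv : v ≠ 0)
    (h : monodromy (driftOp (Real.sqrt (-p)) + (-effectiveGain ε l) • feedbackOp K₁ K₂) v = l • v) :
    IsFloquetMultiplier (hopfField p) !₂[K₁, K₂] (2 * Real.pi) ε (hopfOrbit p) l := by
  set r := Real.sqrt (-p) with hr
  set T := 2 * Real.pi with hT
  have hT0 : 0 < T := Real.two_pi_pos
  set s := effectiveGain ε l with hs
  set N := driftOp r + (-s) • feedbackOp K₁ K₂ with hN
  set f := solOp N (constCLM T (Fin 2 → ℂ) v) with hf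
  let y : ℕ → C(Icc (0 : ℝ) T, Fin 2 → ℂ) := fun k => l⁻¹ ^ k • f
  have hfr : f (rightEnd T) = l • v := h
  have hfl : f (leftEnd T) = v := solOp_leftEnd N _
  have hym : ∀ k, y (k + 1) (rightEnd T) = y k (leftEnd T) := fun k => by
    simp only [y]
    rw [ContinuousMap.smul_apply, ContinuousMap.smul_apply, hfr, hfl, smul_smul, pow_succ,
      mul_assoc, inv_mul_cancel₀ hl0, mul_one]
  set Y := glue y with hY
  have hYc : ContinuousOn Y (Icc (-T) T) := by simpa using continuousOn_glue hym 1
  have hYd : ∀ t ∈ Icc (0 : ℝ) T, HasDerivWithinAt Y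
      (matCLM (driftMat r) (Y t) + (-s) • matCLM (feedbackMat K₁ K₂ t) (Y t)) (Icc 0 T) t := by
    intro t ht
    have h0 : ∀ t ∈ Icc (0 : ℝ) T, Y t = IccExtend hT0.le f t := fun t ht => by
      rw [hY, glue_eq hym 0 (by simpa using ht)]
      simp [y]
    have h1 := hasDerivWithinAt_solOp N v ⟨t, ht⟩
    rw [h0 t ht, IccExtend_of_mem _ _ ht]
    exact h1.congr h0 (h0 t ht)
  have hYs : ∀ t ∈ Icc (-T) 0, Y (t + T) = l • Y t := fun t ht => by
    rw [hY, glue_eq hym 0 (t := t + T) (by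
        simp only [Nat.cast_zero, zero_mul, neg_zero, zero_add]
        exact ⟨by linarith [ht.1], by linarith [ht.2]⟩),
      glue_eq hym 1 (t := t) (by simpa using ht)]
    have hm : t + T ∈ Icc (0 : ℝ) T := ⟨by linarith [ht.1], by linarith [ht.2]⟩
    simp only [Nat.cast_zero, Nat.cast_one, zero_mul, one_mul, add_zero, y, pow_zero, pow_one,
      one_smul]
    rw [IccExtend_of_mem _ _ hm, IccExtend_of_mem _ _ hm, ContinuousMap.smul_apply, smul_smul,
      mul_inv_cancel₀ hl0, one_smul]
  set b : ℂ := ε / (l - 1 + ε) with hb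
  -- The feedback sees `yt - y = (b - 1) y`, which is the reduced gain `-s`.
  have hbs : b - 1 = -s := by rw [hb, hs, effectiveGain]; field_simp; ring
  have hbl : l * b = (1 - ε) * b + ε := by rw [hb]; field_simp; ring
  let z : ℝ → Fin 2 → ℂ := fun t => ![Real.sin t * Y t 0 + Real.cos t * Y t 1,
    -(Real.cos t * Y t 0) + Real.sin t * Y t 1]
  have hz : ∀ t ∈ Icc (-T) 0, z (t + T) = l • z t := fun t ht => by
    have h1 := congrFun (hYs t ht)
    simp only [Pi.smul_apply, smul_eq_mul] at h1
    ext i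
    fin_cases i <;> simp only [z, h1] <;> simp [hT, -Complex.ofReal_sin, -Complex.ofReal_cos] <;>
      ring
  have hzc : ContinuousOn z (Icc (-T) T) := by
    have h1 := continuousOn_pi.1 hYc
    have hsin : ContinuousOn (fun t : ℝ => (Real.sin t : ℂ)) (Icc (-T) T) := by fun_prop
    have hcos : ContinuousOn (fun t : ℝ => (Real.cos t : ℂ)) (Icc (-T) T) := by fun_prop
    refine continuousOn_pi.2 fun i => ?_
    fin_cases i
    · exact (hsin.mul (h1 0)).add (hcos.mul (h1 1))
    · exact (hcos.mul (h1 0)).neg.add (hsin.mul (h1 1))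
  refine ⟨z, fun t => b • z t, hzc, hzc.const_smul b, ?_, ?_, ?_, ?_⟩
  · intro t ht i
    have hsin := (Real.hasDerivAt_sin t).ofReal_comp.hasDerivWithinAt (s := Icc 0 T)
    have hcos := (Real.hasDerivAt_cos t).ofReal_comp.hasDerivWithinAt (s := Icc 0 T)
    have hd := hasDerivWithinAt_pi.1 (hYd t ht)
    have d0 := hd 0
    have d1 := hd 1
    have hsc : (Real.sin t : ℂ) ^ 2 + (Real.cos t : ℂ) ^ 2 = 1 := by
      exact_mod_cast Real.sin_sq_add_cos_sq t
    rw [jacobian_hopfField hp, inputVector_hopfField, ← hr]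
    rw [Pi.add_apply, Pi.smul_apply, matCLM_apply, matCLM_apply] at d0 d1
    fin_cases i
    · refine ((hsin.mul d0).add (hcos.mul d1)).congr_deriv ?_
      simp [Fin.sum_univ_two, z, driftMat, feedbackMat, -Complex.ofReal_sin, -Complex.ofReal_cos]
      linear_combination (-(2 * r ^ 2 * Real.sin t * Y t 0) - s * (K₁ * (Real.sin t * Y t 0 +
        Real.cos t * Y t 1) + K₂ * (-(Real.cos t * Y t 0) + Real.sin t * Y t 1))) * hsc -
        (K₁ * (Real.sin t * Y t 0 + Real.cos t * Y t 1) +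
          K₂ * (-(Real.cos t * Y t 0) + Real.sin t * Y t 1)) * hbs
    · refine ((hcos.mul d0).neg.add (hsin.mul d1)).congr_deriv ?_
      simp [Fin.sum_univ_two, z, driftMat, feedbackMat, -Complex.ofReal_sin, -Complex.ofReal_cos]
      linear_combination (2 * r ^ 2 * Real.cos t * Y t 0 - s * (K₁ * (Real.sin t * Y t 0 +
        Real.cos t * Y t 1) + K₂ * (-(Real.cos t * Y t 0) + Real.sin t * Y t 1))) * hsc -
        (K₁ * (Real.sin t * Y t 0 + Real.cos t * Y t 1) +
          K₂ * (-(Real.cos t * Y t 0) + Real.sin t * Y t 1)) * hbs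
  · intro t ht
    have h1 := hz (t - T) ⟨by linarith [ht.1], by linarith [ht.2]⟩
    rw [sub_add_cancel] at h1
    simp only
    rw [h1, smul_smul, smul_smul, mul_comm b l, hbl, add_smul]
    push_cast
    rfl
  · intro t ht
    refine ⟨hz t ht, ?_⟩
    simp only
    rw [hz t ht, smul_comm]
  · refine ⟨0, ⟨by linarith, le_rfl⟩, Or.inl fun h0 => hv ?_⟩
    have hY0 : Y 0 = v := by
      rw [hY, glue_eq hym 0 (t := 0) (by simpa using hT0.le), ← hfl]
      simp only [y, Nat.cast_zero, zero_mul, add_zero, pow_zero, one_smul]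
      rw [IccExtend_left]; rfl
    have e0 := congrFun h0 0
    have e1 := congrFun h0 1
    simp [z, hY0] at e0 e1
    ext i
    fin_cases i
    · exact e1
    · exact e0

end Hopf

/-! ### The nonlinear remainder and the rotating coordinates. -/

section Instability

open Filter Topology

/-- The nonlinear part of the Hopf normal form around the orbit, in the rotating frame. -/
noncomputable def hopfNonlin (r : ℝ) : C(Fin 2 → ℂ, Fin 2 → ℂ) :=
  ⟨fun w => ![3 * r * w 0 ^ 2 + r * w 1 ^ 2 + w 0 * (w 0 ^ 2 + w 1 ^ 2),
    2 * r * (w 0 * w 1) + w 1 * (w 0 ^ 2 + w 1 ^ 2)], by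
    refine continuous_pi fun i => ?_
    fin_cases i <;> simp <;> fun_prop⟩

theorem hopfNonlin_apply (r : ℝ) (w : Fin 2 → ℂ) : hopfNonlin r w =
    ![3 * r * w 0 ^ 2 + r * w 1 ^ 2 + w 0 * (w 0 ^ 2 + w 1 ^ 2),
      2 * r * (w 0 * w 1) + w 1 * (w 0 ^ 2 + w 1 ^ 2)] := rfl

theorem norm_mul_sub_mul_le (a b c d : ℂ) :
    ‖a * c - b * d‖ ≤ ‖a‖ * ‖c - d‖ + ‖d‖ * ‖a - b‖ := by
  have : a * c - b * d = a * (c - d) + d * (a - b) := by ring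
  rw [this]
  exact (norm_add_le _ _).trans (by rw [norm_mul, norm_mul])

/-- Quadratic terms contribute at most `4|r|`; in the cubic ones the unit ball absorbs one factor,
which leaves at most `4`. -/
theorem norm_hopfNonlin_sub_le (r : ℝ) (a b : Fin 2 → ℂ) (ha : ‖a‖ ≤ 1) (hb : ‖b‖ ≤ 1) :
    ‖hopfNonlin r a - hopfNonlin r b‖ ≤ (4 * |r| + 4) * (‖a‖ + ‖b‖) * ‖a - b‖ := by
  set σ := ‖a‖ + ‖b‖ with hσ
  set δ := ‖a - b‖ with hδ
  have hσ0 : 0 ≤ σ := by positivity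
  have hδ0 : 0 ≤ δ := norm_nonneg _
  have h1 : ∀ i, ‖a i - b i‖ ≤ δ := fun i => norm_le_pi_norm (a - b) i
  have h2 : ∀ i j, ‖a i * a j - b i * b j‖ ≤ σ * δ := fun i j => by
    refine (norm_mul_sub_mul_le _ _ _ _).trans ?_
    rw [hσ, add_mul]
    exact add_le_add (mul_le_mul (norm_le_pi_norm a i) (h1 j) (norm_nonneg _) (norm_nonneg _))
      (mul_le_mul (norm_le_pi_norm b j) (h1 i) (norm_nonneg _) (norm_nonneg _))
  have h3 : ∀ i j, ‖a i * (a j * a j) - b i * (b j * b j)‖ ≤ 2 * (σ * δ) := fun i j => by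
    refine (norm_mul_sub_mul_le _ _ _ _).trans ?_
    have e1 : ‖a i‖ * ‖a j * a j - b j * b j‖ ≤ 1 * (σ * δ) :=
      mul_le_mul ((norm_le_pi_norm a i).trans ha) (h2 j j) (norm_nonneg _) zero_le_one
    have e2 : ‖b j * b j‖ ≤ σ := by
      have hbj := norm_le_pi_norm b j
      have h0 := norm_nonneg (b j)
      have h0' := norm_nonneg a
      rw [norm_mul]
      nlinarith
    have e3 : ‖b j * b j‖ * ‖a i - b i‖ ≤ σ * δ :=
      mul_le_mul e2 (h1 i) (norm_nonneg _) hσ0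
    linarith
  have hr : ‖(r : ℂ)‖ = |r| := by rw [Complex.norm_real, Real.norm_eq_abs]
  have hσδ : 0 ≤ σ * δ := by positivity
  have hr0 := abs_nonneg r
  have hrσ : 0 ≤ |r| * (σ * δ) := by positivity
  refine (pi_norm_le_iff_of_nonneg (by positivity)).2 fun i => ?_
  rw [Pi.sub_apply, hopfNonlin_apply, hopfNonlin_apply]
  fin_cases i
  · have e : (3 * r * a 0 ^ 2 + r * a 1 ^ 2 + a 0 * (a 0 ^ 2 + a 1 ^ 2)) -
        (3 * r * b 0 ^ 2 + r * b 1 ^ 2 + b 0 * (b 0 ^ 2 + b 1 ^ 2)) =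
        (3 * r) * (a 0 * a 0 - b 0 * b 0) + r * (a 1 * a 1 - b 1 * b 1) +
        (a 0 * (a 0 * a 0) - b 0 * (b 0 * b 0)) + (a 0 * (a 1 * a 1) - b 0 * (b 1 * b 1)) := by
      ring
    change ‖(3 * r * a 0 ^ 2 + r * a 1 ^ 2 + a 0 * (a 0 ^ 2 + a 1 ^ 2)) -
        (3 * r * b 0 ^ 2 + r * b 1 ^ 2 + b 0 * (b 0 ^ 2 + b 1 ^ 2))‖ ≤ _
    rw [e]
    refine (norm_add₄_le).trans ?_
    rw [norm_mul, norm_mul, norm_mul, hr]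
    have e1 := mul_le_mul_of_nonneg_left (h2 0 0) hr0
    have e2 := mul_le_mul_of_nonneg_left (h2 1 1) hr0
    have e3 := h3 0 0
    have e4 := h3 0 1
    norm_num
    nlinarith
  · have e : (2 * r * (a 0 * a 1) + a 1 * (a 0 ^ 2 + a 1 ^ 2)) -
        (2 * r * (b 0 * b 1) + b 1 * (b 0 ^ 2 + b 1 ^ 2)) =
        (2 * r) * (a 0 * a 1 - b 0 * b 1) +
        (a 1 * (a 0 * a 0) - b 1 * (b 0 * b 0)) + (a 1 * (a 1 * a 1) - b 1 * (b 1 * b 1)) := by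
      ring
    change ‖(2 * r * (a 0 * a 1) + a 1 * (a 0 ^ 2 + a 1 ^ 2)) -
        (2 * r * (b 0 * b 1) + b 1 * (b 0 ^ 2 + b 1 ^ 2))‖ ≤ _
    rw [e]
    refine (norm_add₃_le).trans ?_
    rw [norm_mul, norm_mul, hr]
    have e1 := mul_le_mul_of_nonneg_left (h2 0 1) hr0
    have e3 := h3 1 0
    have e4 := h3 1 1
    norm_num
    nlinarith

theorem rePart_hopfNonlin (r : ℝ) (a : Fin 2 → ℂ) :
    rePart (hopfNonlin r (rePart a)) = hopfNonlin r (rePart a) := by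
  ext i
  rw [rePart_apply, hopfNonlin_apply]
  fin_cases i
  · have : 3 * (r : ℂ) * rePart a 0 ^ 2 + r * rePart a 1 ^ 2 +
        rePart a 0 * (rePart a 0 ^ 2 + rePart a 1 ^ 2) =
        ((3 * r * (a 0).re ^ 2 + r * (a 1).re ^ 2 +
          (a 0).re * ((a 0).re ^ 2 + (a 1).re ^ 2) : ℝ) : ℂ) := by simp
    change ((3 * (r : ℂ) * rePart a 0 ^ 2 + r * rePart a 1 ^ 2 +
        rePart a 0 * (rePart a 0 ^ 2 + rePart a 1 ^ 2)).re : ℂ) =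
        3 * (r : ℂ) * rePart a 0 ^ 2 + r * rePart a 1 ^ 2 +
        rePart a 0 * (rePart a 0 ^ 2 + rePart a 1 ^ 2)
    rw [this, Complex.ofReal_re]
  · have : 2 * (r : ℂ) * (rePart a 0 * rePart a 1) +
        rePart a 1 * (rePart a 0 ^ 2 + rePart a 1 ^ 2) =
        ((2 * r * ((a 0).re * (a 1).re) +
          (a 1).re * ((a 0).re ^ 2 + (a 1).re ^ 2) : ℝ) : ℂ) := by simp
    change ((2 * (r : ℂ) * (rePart a 0 * rePart a 1) +
        rePart a 1 * (rePart a 0 ^ 2 + rePart a 1 ^ 2)).re : ℂ) =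
        2 * (r : ℂ) * (rePart a 0 * rePart a 1) +
        rePart a 1 * (rePart a 0 ^ 2 + rePart a 1 ^ 2)
    rw [this, Complex.ofReal_re]

/-- The vector with rotating coordinates `w` at time `t`. -/
noncomputable def rotVec (t : ℝ) (w : Fin 2 → ℂ) : State 2 :=
  !₂[Real.sin t * (w 0).re + Real.cos t * (w 1).re,
    -(Real.cos t * (w 0).re) + Real.sin t * (w 1).re]

theorem norm_rotVec_le (t : ℝ) (w : Fin 2 → ℂ) : ‖rotVec t w‖ ≤ 2 * ‖w‖ := by
  have h0 := (Complex.abs_re_le_norm _).trans (norm_le_pi_norm w 0)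
  have h1 := (Complex.abs_re_le_norm _).trans (norm_le_pi_norm w 1)
  have hsq : ‖rotVec t w‖ ^ 2 = (w 0).re ^ 2 + (w 1).re ^ 2 := by
    rw [EuclideanSpace.norm_sq_eq, Fin.sum_univ_two]
    simp only [rotVec, Real.norm_eq_abs, sq_abs]
    simp
    linear_combination ((w 0).re ^ 2 + (w 1).re ^ 2) * Real.sin_sq_add_cos_sq t
  have e0 : (w 0).re ^ 2 ≤ ‖w‖ ^ 2 := sq_le_sq' (by linarith [neg_abs_le (w 0).re])
    ((le_abs_self _).trans h0)
  have e1 : (w 1).re ^ 2 ≤ ‖w‖ ^ 2 := sq_le_sq' (by linarith [neg_abs_le (w 1).re])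
    ((le_abs_self _).trans h1)
  refine abs_le_of_sq_le_sq' ?_ (by positivity) |>.2
  nlinarith [norm_nonneg w]

theorem rotVec_periodic (w : Fin 2 → ℂ) : Function.Periodic (rotVec · w) (2 * Real.pi) :=
  fun t => by simp [rotVec]

theorem eq_of_rotVec_eq {t : ℝ} {v w : Fin 2 → ℂ} (h : rotVec t v = rotVec t w)
    (hv : rePart v = v) (hw : rePart w = w) : v = w := by
  have h0 := congrArg (fun x : State 2 => x 0) h
  have h1 := congrArg (fun x : State 2 => x 1) h
  simp [rotVec] at h0 h1
  have hsc := Real.sin_sq_add_cos_sq t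
  rw [← hv, ← hw]
  ext i
  rw [rePart_apply, rePart_apply, Complex.ofReal_inj]
  fin_cases i
  · change (v 0).re = (w 0).re
    linear_combination Real.sin t * h0 - Real.cos t * h1 - ((v 0).re - (w 0).re) * hsc
  · change (v 1).re = (w 1).re
    linear_combination Real.cos t * h0 + Real.sin t * h1 - ((v 1).re - (w 1).re) * hsc

/-- The eigenfunction starts at `v`, hence is nonzero, and `l - blockOp` is not injective. -/
theorem mem_spectrum_blockOp_of_monodromy {T : ℝ} [Fact (0 < T)] {F : Type*}
    [NormedAddCommGroup F] [NormedSpace ℂ F] [CompleteSpace F]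
    (M C : C(Icc (0 : ℝ) T, F →L[ℂ] F)) {ε l : ℂ} (hl : l - 1 + ε ≠ 0) {v : F} (hv0 : v ≠ 0)
    (hv : monodromy (M + (ε / (l - 1 + ε)) • C) v = l • v) :
    l ∈ spectrum ℂ (blockOp M C ε) := by
  have h := blockOp_eq_smul_of_monodromy M C hl hv
  intro hu
  rw [spectrum.mem_resolventSet_iff, Algebra.algebraMap_eq_smul_one,
    ContinuousLinearMap.isUnit_iff_bijective] at hu
  have h0 := (injective_iff_map_eq_zero _).1 hu.1 _ (sub_eq_zero.2 h.symm)
  have h1 : solOp (M + (ε / (l - 1 + ε)) • C) (constCLM T F v) = 0 := congrArg Prod.fst h0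
  have h2 := solOp_leftEnd (M + (ε / (l - 1 + ε)) • C) (constCLM T F v)
  rw [h1] at h2
  exact hv0 h2.symm

end Instability

/-! ### Orbital instability and the theorem. -/

section Main

open Filter Topology

theorem continuousOn_rotVec {u : ℝ → Fin 2 → ℂ} {s : Set ℝ} (hu : ContinuousOn u s) :
    ContinuousOn (fun t => rotVec t (u t)) s := by
  have h : ∀ i, ContinuousOn (fun t => (u t i).re) s := fun i =>
    Complex.continuous_re.comp_continuousOn (continuousOn_pi.1 hu i)
  exact continuousOn_vec ((Real.continuous_sin.continuousOn.mul (h 0)).add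
    (Real.continuous_cos.continuousOn.mul (h 1)))
    ((Real.continuous_cos.continuousOn.mul (h 0)).neg.add
      (Real.continuous_sin.continuousOn.mul (h 1)))

theorem continuous_hopfOrbit (p : ℝ) : Continuous (hopfOrbit p) :=
  continuousOn_univ.1 (continuousOn_vec (by fun_prop) (by fun_prop))

/-- A real solution of the linearised equation with nonlinearity in the rotating frame yields a
solution of the Hopf normal form with feedback. -/
theorem hasDerivWithinAt_hopf {p : ℝ} (hp : p < 0) (K₁ K₂ : ℝ) {u : ℝ → Fin 2 → ℂ}
    {w : Fin 2 → ℂ} {s : Set ℝ} {t : ℝ} (hur : rePart (u t) = u t) (hwr : rePart w = w)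
    (hu : HasDerivWithinAt u (matCLM (driftMat (Real.sqrt (-p)) - feedbackMat K₁ K₂ t) (u t) +
      matCLM (feedbackMat K₁ K₂ t) w + hopfNonlin (Real.sqrt (-p)) (u t)) s t) :
    HasDerivWithinAt (fun t => hopfOrbit p t + rotVec t (u t))
      (hopfField p (hopfOrbit p t + rotVec t (u t))
        (∑ j, (!₂[K₁, K₂] : State 2) j * ((hopfOrbit p t + rotVec t w) j -
          (hopfOrbit p t + rotVec t (u t)) j))) s t := by
  have hr2 : Real.sqrt (-p) ^ 2 = -p := Real.sq_sqrt (by linarith)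
  set r := Real.sqrt (-p) with hr
  have hre : ∀ i, HasDerivWithinAt (fun t => (u t i).re) _ s t := fun i =>
    Complex.reCLM.hasFDerivAt.comp_hasDerivWithinAt t (hasDerivWithinAt_pi.1 hu i)
  have d0 := hre 0
  have d1 := hre 1
  set a := (u t 0).re with ha
  set b := (u t 1).re with hb
  set c := (w 0).re with hc
  set d := (w 1).re with hd
  have hu0 : u t 0 = (a : ℂ) := (congrFun hur 0).symm
  have hu1 : u t 1 = (b : ℂ) := (congrFun hur 1).symm
  have hw0 : w 0 = (c : ℂ) := (congrFun hwr 0).symm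
  have hw1 : w 1 = (d : ℂ) := (congrFun hwr 1).symm
  have hsin := (Real.hasDerivAt_sin t).hasDerivWithinAt (s := s)
  have hcos := (Real.hasDerivAt_cos t).hasDerivWithinAt (s := s)
  set S := Real.sin t with hS
  set C := Real.cos t with hC
  have hsc : S ^ 2 + C ^ 2 = 1 := Real.sin_sq_add_cos_sq t
  have d0' : HasDerivWithinAt (fun t => (u t 0).re)
      (2 * r ^ 2 * a - (S - C) * ((K₁ * S - K₂ * C) * (a - c) + (K₁ * C + K₂ * S) * (b - d)) +
        (3 * r * a ^ 2 + r * b ^ 2 + a * (a ^ 2 + b ^ 2))) s t := by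
    refine d0.congr_deriv ?_
    rw [Complex.reCLM_apply, Pi.add_apply, Pi.add_apply, matCLM_apply, matCLM_apply,
      hopfNonlin_apply, hu0, hu1, hw0, hw1]
    simp [driftMat, feedbackMat, ← Complex.ofReal_pow, -Complex.ofReal_sin, -Complex.ofReal_cos,
      ← hS, ← hC]
    ring
  have d1' : HasDerivWithinAt (fun t => (u t 1).re)
      (-((C + S) * ((K₁ * S - K₂ * C) * (a - c) + (K₁ * C + K₂ * S) * (b - d))) +
        (2 * r * (a * b) + b * (a ^ 2 + b ^ 2))) s t := by
    refine d1.congr_deriv ?_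
    rw [Complex.reCLM_apply, Pi.add_apply, Pi.add_apply, matCLM_apply, matCLM_apply,
      hopfNonlin_apply, hu0, hu1, hw0, hw1]
    simp [driftMat, feedbackMat, ← Complex.ofReal_pow, -Complex.ofReal_sin, -Complex.ofReal_cos,
      ← hS, ← hC]
    ring
  have hx0 := (hsin.const_mul r).add ((hsin.mul d0').add (hcos.mul d1'))
  have hx1 := (hcos.const_mul r).neg.add ((hcos.mul d0').neg.add (hsin.mul d1'))
  have hx := hasDerivWithinAt_vec hx0 hx1
  have he : (fun t => hopfOrbit p t + rotVec t (u t)) = fun t =>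
      !₂[(r * Real.sin t + (Real.sin t * (u t 0).re + Real.cos t * (u t 1).re)),
        (-(r * Real.cos t) + (-(Real.cos t * (u t 0).re) + Real.sin t * (u t 1).re))] := by
    funext t; ext i; fin_cases i <;> simp [hopfOrbit, rotVec, hr]
  rw [he]
  refine hx.congr_deriv ?_
  -- The orbit has rotating coordinates `(r, 0)`, and the rotation preserves the Euclidean norm.
  have hq : (r * S + (S * a + C * b)) ^ 2 + (-(r * C) + (-(C * a) + S * b)) ^ 2 =
      (r + a) ^ 2 + b ^ 2 := by
    linear_combination ((r + a) ^ 2 + b ^ 2) * hsc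
  have hp' : p = -r ^ 2 := by rw [hr2]; ring
  ext i
  fin_cases i
  · simp [hopfField, hopfOrbit, rotVec, Fin.sum_univ_two, ← hS, ← hC, ← hr, ← ha, ← hb, ← hc, ← hd]
    rw [hq, hp']
    linear_combination
      (-((K₁ * S - K₂ * C) * (a - c) + (K₁ * C + K₂ * S) * (b - d))) * hsc
  · simp [hopfField, hopfOrbit, rotVec, Fin.sum_univ_two, ← hS, ← hC, ← hr, ← ha, ← hb, ← hc, ← hd]
    rw [hq, hp']
    linear_combination
      (-((K₁ * S - K₂ * C) * (a - c) + (K₁ * C + K₂ * S) * (b - d))) * hsc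

/-- A segment close to the orbit at phase `s` has both end points near `hopfOrbit p s`, whatever `s`
is. Failure of `T`-periodicity thus excludes all phases at once, without tracking any phase drift.
-/
theorem not_orbitallyStable_of_monodromy {p : ℝ} (hp : p < 0) {K₁ K₂ ε : ℝ} (hε0 : 0 < ε)
    (hε1 : ε < 1) {l : ℂ} (hl1 : 1 < ‖l‖) {v : Fin 2 → ℂ} (hv0 : v ≠ 0)
    (hv : monodromy (driftOp (Real.sqrt (-p)) + (-effectiveGain ε l) • feedbackOp K₁ K₂) v =
      l • v) :
    ¬ OrbitallyStable (hopfField p) !₂[K₁, K₂] (2 * Real.pi) ε (hopfOrbit p) := by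
  set r := Real.sqrt (-p) with hr
  have hT0 := Real.two_pi_pos
  have hl : l - 1 + (ε : ℂ) ≠ 0 := sub_one_add_ne_zero hε0.le hε1.le hl1
  let M : ℝ → (Fin 2 → ℂ) →L[ℂ] (Fin 2 → ℂ) := fun t => matCLM (driftMat r - feedbackMat K₁ K₂ t)
  let C : ℝ → (Fin 2 → ℂ) →L[ℂ] (Fin 2 → ℂ) := fun t => matCLM (feedbackMat K₁ K₂ t)
  have hMc : Continuous M :=
    continuous_matCLM.comp (continuous_const.sub (continuous_feedbackMat K₁ K₂))
  have hCc : Continuous C := continuous_matCLM.comp (continuous_feedbackMat K₁ K₂)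
  have hMT : Function.Periodic M (2 * Real.pi) := fun t => by
    simp only [M]; rw [feedbackMat_periodic K₁ K₂ t]
  have hCT : Function.Periodic C (2 * Real.pi) := fun t => by
    simp only [C]; rw [feedbackMat_periodic K₁ K₂ t]
  have hN : (⟨fun t => M t, by fun_prop⟩ : C(Icc (0 : ℝ) (2 * Real.pi), _)) +
      ((ε : ℂ) / (l - 1 + ε)) • ⟨fun t => C t, by fun_prop⟩ =
      driftOp r + (-effectiveGain ε l) • feedbackOp K₁ K₂ := by
    ext t a i
    change matCLM (driftMat r - feedbackMat K₁ K₂ t) a i +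
      ((ε : ℂ) / (l - 1 + ε)) * matCLM (feedbackMat K₁ K₂ t) a i =
      matCLM (driftMat r) a i + (-effectiveGain ε l) * matCLM (feedbackMat K₁ K₂ t) a i
    have hb : (ε : ℂ) / (l - 1 + ε) = 1 - effectiveGain ε l := by
      rw [effectiveGain]; field_simp; ring
    rw [hb, matCLM_apply, matCLM_apply, matCLM_apply, Matrix.sub_apply, Matrix.sub_apply]
    push_cast
    ring
  have hspec := mem_spectrum_blockOp_of_monodromy
    (⟨fun t => M t, by fun_prop⟩ : C(Icc (0 : ℝ) (2 * Real.pi), _)) ⟨fun t => C t, by fun_prop⟩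
    hl hv0 (by rw [hN]; exact hv)
  obtain ⟨Y, W, hYc, hWc, hYd, hrec, hYr, hWr, hsmall, t₀, ht₀, hne⟩ :=
    exists_delay_solution hMc hCc hMT hCT hε0 hε1 (R := rePart)
      (fun a => (pi_norm_le_iff_of_nonneg (norm_nonneg _)).2 fun i => by
        rw [rePart_apply, Complex.norm_real]
        exact (Complex.abs_re_le_norm _).trans (norm_le_pi_norm a i))
      (fun a => by ext i; simp)
      (fun a h h' => by
        ext i
        have e1 := congrFun h i
        have e2 := congrFun h' i
        simp at e1 e2
        exact Complex.ext e1 e2)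
      (fun t => rePart_matCLM _) (fun t => rePart_matCLM _) (hopfNonlin r)
      (by ext i; rw [hopfNonlin_apply]; fin_cases i <;> simp) (by positivity)
      (norm_hopfNonlin_sub_le r) (rePart_hopfNonlin r) hspec hl1
  intro hstab
  -- This is half the distance between the two end points, fixed before `δ` is known.
  set η := dist (rotVec t₀ (Y t₀)) (rotVec t₀ (Y (t₀ - 2 * Real.pi))) / 2 with hη
  have hη0 : 0 < η := by
    refine half_pos (dist_pos.2 fun h => hne ?_)
    exact eq_of_rotVec_eq h (hYr _) (hYr _)
  obtain ⟨δ, hδ, H⟩ := hstab η hη0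
  obtain ⟨t₁, ht₁⟩ := hsmall (δ / 2) (half_pos hδ)
  -- A shift by `m` whole periods leaves the rotating frame and the coefficients unchanged. It moves
  -- the initial segment to times before `t₁` and makes the observation time nonnegative.
  obtain ⟨m, hm⟩ := exists_nat_ge ((|t₁| + |t₀|) / (2 * Real.pi))
  rw [div_le_iff₀ hT0] at hm
  have hmt₁ : -(m * (2 * Real.pi)) ≤ t₁ := by
    linarith [neg_abs_le t₁, abs_nonneg t₀]
  have hmt₀ : 0 ≤ t₀ + m * (2 * Real.pi) := by
    linarith [neg_abs_le t₀, abs_nonneg t₁]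
  set τ := m * (2 * Real.pi) + 2 * Real.pi with hτ
  have hmpos : 0 ≤ m * (2 * Real.pi) := by positivity
  let x : ℝ → State 2 := fun t => hopfOrbit p t + rotVec t (Y (t - m * (2 * Real.pi)))
  let xt : ℝ → State 2 := fun t => hopfOrbit p t + rotVec t (W (t - m * (2 * Real.pi)))
  have hmaps : MapsTo (fun t : ℝ => t - m * (2 * Real.pi)) (Icc (-(2 * Real.pi)) τ)
      (Icc (-((m + 1 : ℕ) * (2 * Real.pi))) (2 * Real.pi)) := fun t ht => by
    push_cast
    exact ⟨by linarith [ht.1], by linarith [ht.2]⟩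
  have hsol : IsSolution (hopfField p) !₂[K₁, K₂] (2 * Real.pi) ε τ x xt := by
    refine ⟨?_, ?_, ?_, ?_⟩
    · exact (continuous_hopfOrbit p).continuousOn.add (continuousOn_rotVec
        ((hYc (m + 1)).comp (by fun_prop) hmaps))
    · exact (continuous_hopfOrbit p).continuousOn.add (continuousOn_rotVec
        ((hWc (m + 1)).comp (by fun_prop) hmaps))
    · intro t ht
      have hsub : Icc 0 τ ⊆ Icc (-(2 * Real.pi)) τ := Icc_subset_Icc_left (by linarith)
      have h1 := hYd (m + 1) _ (hmaps (hsub ht))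
      have h2 : HasDerivWithinAt (fun t : ℝ => t - m * (2 * Real.pi)) 1 (Icc 0 τ) t :=
        ((hasDerivAt_id t).sub_const _).hasDerivWithinAt
      have h3 := HasDerivWithinAt.scomp t h1 h2 (hmaps.mono_left hsub)
      rw [one_smul, hMT.sub_nat_mul_eq, hCT.sub_nat_mul_eq] at h3
      exact hasDerivWithinAt_hopf hp K₁ K₂ (u := fun t => Y (t - m * (2 * Real.pi)))
        (hYr _) (hWr _) h3
    · intro t ht
      have h1 := hrec (t - m * (2 * Real.pi)) (by linarith [ht.2])
      have e : t - 2 * Real.pi - m * (2 * Real.pi) = t - m * (2 * Real.pi) - 2 * Real.pi := by ring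
      simp only [x, xt]
      rw [h1, e, (hopfOrbit_periodic p).sub_eq, (rotVec_periodic _).sub_eq,
        (rotVec_periodic _).sub_eq]
      ext i
      fin_cases i <;> simp [rotVec] <;> ring
  have hclose : SegmentClose (2 * Real.pi) δ x xt (hopfOrbit p) 0 0 := fun θ hθ => by
    have h1 := ht₁ (θ - m * (2 * Real.pi)) (by linarith [hθ.2])
    have h2 := norm_rotVec_le θ (Y (θ - m * (2 * Real.pi)))
    have h3 := norm_rotVec_le θ (W (θ - m * (2 * Real.pi)))
    simp only [zero_add, x, xt, dist_self_add_left]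
    exact ⟨by linarith, by linarith⟩
  have htm : t₀ + m * (2 * Real.pi) ∈ Icc 0 τ := ⟨hmt₀, by linarith⟩
  obtain ⟨s, hs⟩ := H τ (by positivity) x xt hsol ⟨0, hclose⟩ _ htm
  have h1 := (hs 0 ⟨by linarith, le_rfl⟩).1
  have h2 := (hs (-(2 * Real.pi)) ⟨le_rfl, by linarith⟩).1
  rw [← sub_eq_add_neg, ← sub_eq_add_neg, (hopfOrbit_periodic p).sub_eq] at h2
  rw [add_zero, add_zero] at h1
  have hrot : ∀ a, rotVec (t₀ + m * (2 * Real.pi)) a = rotVec t₀ a := fun a =>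
    (rotVec_periodic a).nat_mul m t₀
  have e1 : x (t₀ + m * (2 * Real.pi)) = hopfOrbit p t₀ + rotVec t₀ (Y t₀) := by
    simp only [x]
    rw [add_sub_cancel_right, (hopfOrbit_periodic p).nat_mul m t₀, hrot]
  have e2 : x (t₀ + m * (2 * Real.pi) - 2 * Real.pi) =
      hopfOrbit p t₀ + rotVec t₀ (Y (t₀ - 2 * Real.pi)) := by
    simp only [x]
    rw [show t₀ + m * (2 * Real.pi) - 2 * Real.pi - m * (2 * Real.pi) = t₀ - 2 * Real.pi by ring,
      (hopfOrbit_periodic p).sub_eq, (rotVec_periodic _).sub_eq,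
      (hopfOrbit_periodic p).nat_mul m t₀, hrot]
  rw [e1] at h1
  rw [e2] at h2
  have h3 := dist_triangle_right (hopfOrbit p t₀ + rotVec t₀ (Y t₀))
    (hopfOrbit p t₀ + rotVec t₀ (Y (t₀ - 2 * Real.pi))) (hopfOrbit p s)
  rw [dist_add_left] at h3
  linarith

end Main

end ETDF

theorem mainTheorem5 (p : ℝ) (hp : p < 0) (K₁ K₂ : ℝ) :
    ∃ εmax : ℝ, 0 < εmax ∧ ∀ ε : ℝ, 0 < ε → ε < εmax →
      (∃ l : ℂ, 1 < ‖l‖ ∧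
        ETDF.IsFloquetMultiplier (ETDF.hopfField p) !₂[K₁, K₂] (2 * Real.pi) ε
          (ETDF.hopfOrbit p) l) ∧
      ¬ ETDF.OrbitallyStable (ETDF.hopfField p) !₂[K₁, K₂] (2 * Real.pi) ε
          (ETDF.hopfOrbit p) := by
  have hr : Real.sqrt (-p) ≠ 0 := (Real.sqrt_pos.2 (by linarith)).ne'
  obtain ⟨ε₀, hε₀, hε₀1, h⟩ := ETDF.exists_unstable_multiplier (Real.sqrt (-p)) K₁ K₂ hr
  refine ⟨ε₀, hε₀, fun ε h0 h1 => ?_⟩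
  obtain ⟨l, hl, v, hv, hm⟩ := h ε h0 h1
  have hε1 : ε < 1 := h1.trans_le hε₀1
  exact ⟨⟨l, hl, ETDF.isFloquetMultiplier_of_monodromy hp (by rintro rfl; norm_num at hl)
    (ETDF.sub_one_add_ne_zero h0.le hε1.le hl) hv hm⟩,
    ETDF.not_orbitallyStable_of_monodromy hp h0 hε1 hl hv hm⟩
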